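/- **Setting.** Let $N\ge 2$, $n\ge 1$. Agents $i=1,\dots,N$ have states $x_i(t)\in\mathbb R^n$ with $x_i(t+1)=Ax_i(t)+Bu_i(t)$, where $(A,B)$ is in Brunovsky canonical form: $A$ is the companion matrix with ones on the superdiagonal and last row $(a_1,\dots,a_n)$, and $B=[0,\dots,0,1]^T$. Let $b_1,\dots,b_{n-1}\in\mathbb R$, $b_0=0$, $b_n=1$, $K_2=[b_1,\dots,b_{n-1},1]$, and let $K_1$ be the row vector with entries $-a_k+b_k-b_{k-1}$, $k=1,\dots,n$. Let $G_1,\dots,G_h$ be undirected graphs on $\{1,\dots,N\}$ without self-loops that are jointly connected, i.e. their union $G'$ is connected; $N_i$ and $d_i$ are the neighbour set and the degree of $i$ in $G'$. Let $m(t)$, $t\in\mathbb N$, be a homogeneous, irreducible Markov chain on $\{1,\dots,h\}$ with $\pi_u=\lim_{t\to\infty}\mathbb P\{m(t)=u\}$ for every $u$; $\pi_{\min}=\min_u\pi_u$ (which is positive). Let the noises $d_{ij}(t)$ be i.i.d. $N(0,\delta^2)$, $\delta>0$, over $i,j,t$, and independent of the chain, with distribution function $F$ and density $f$. Let $\beta\in\mathbb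 R$, $\gamma>0$, $c_{ij}\in\mathbb R$ ($1\le i,j\le N$), and let $t_0>0$ be an integer with $t_0>\gamma d_i-1$ for all $i$. Let $x_i(t_0+1)=x_i^0$ and $\hat z_{ij}(t_0)=\hat z_{ij}^0$ ($j\in N_i$) be deterministic with $|K_2x_i^0|\le M$ and $|\hat z^0_{ij}|\le M$. For $t\ge t_0+1$, with $\Pi_M$ the projection onto $[-M,M]$, $$\hat z_{ij}(t)=\Pi_M\Big\{\hat z_{ij}(t-1)+\tfrac{\beta}{t}\,\mathbb 1_{\{(i,j)\in E_{m(t)}\}}\big(F(c_{ij}-\hat z_{ij}(t-1))-s_{ij}(t)\big)\Big\},\quad j\in N_i,\qquad s_{ij}(t)=\mathbb 1_{\{K_2x_j(t)+d_{ij}(t)\le c_{ij}\}},$$ $$u_i(t)=K_1x_i(t)+\frac{\gamma}{t+1}\sum_{j:(i,j)\in E_{m(t)}}\big(\hat z_{ij}(t)-K_2x_i(t)\big),$$ where $E_u$ is the edge set of $G_u$. **Constants.** Let $L_u$ be the Laplacian of $G_u$, $\check L=\sum_u\pi_uL_u$ with eigenvalues $\lambda_1\le\lambda_2\le\dots\le\lambda_N$,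 $T_G$ orthogonal with $T_G^{-1}\check LT_G=\mathrm{diag}\{\lambda_1,\dots,\lambda_N\}$, and $J_N=I_N-\frac1N\vec 1\vec 1^T$. Index by the ordered edges $(i,j)$ of $G'$: $Q$ is the matrix whose row $(i,j)$ is the $j$-th unit vector of $\mathbb R^N$, and $W_u$ is the matrix whose entry in row $k$, column $(i,j)$ is $1$ if $k=i$ and $(i,j)\in E_u$, and $0$ otherwise. With the spectral norm, put $\lambda_G=\max_u\|T_G^{-1}J_NW_u\|^2$, $\lambda_{QW}=\max_u\|QW_u\|^2$, $\lambda_{QL}=\max_u\|QL_uT_G\|^2$, $\alpha=2\sqrt{\lambda_{QW}}+\lambda_{QL}\lambda_2/\lambda_G$, $f_M=\min_{i,j}f(|c_{ij}|+M)$. Let $\bar x(t)=\frac1N\sum_ix_i(t)$. **Theorem.** For $t\ge t_0+1$ the compressed states $K_2x_i(t)$ and the estimates $\hat z_{ij}(t)$ ($j\in N_i$) have finite second moments, and: i) If $\beta>\frac{1}{2f_M\pi_{\min}}\big(\frac{\gamma\lambda_G^2}{\lambda_2^3}+\gamma\alpha\big)$, then for all $i$ and all $j\in N_i$ $$\lim_{t\to\infty}E\big[|K_2x_i(t)-K_2\bar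 x(t)|^2\big]=0,\qquad \lim_{t\to\infty}E\big[|\hat z_{ij}(t)-K_2x_j(t)|^2\big]=0.$$ ii) If $\gamma>\frac1{\lambda_2}$ and $\beta>\frac{1}{2f_M\pi_{\min}}\big(\frac{\gamma^2\lambda_G^2}{\lambda_2^2(\gamma\lambda_2-1)}+\gamma\alpha+1\big)$, then for all $i$ and all $j\in N_i$ $$E\big[|K_2x_i(t)-K_2\bar x(t)|^2\big]=O\big(\tfrac1t\big),\qquad E\big[|\hat z_{ij}(t)-K_2x_j(t)|^2\big]=O\big(\tfrac1t\big).$$ -/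

import Mathlib

open MeasureTheory ProbabilityTheory Filter Topology Asymptotics
open scoped Matrix NNReal

namespace OneBitConsensus

/-! ### The agents: Brunovsky canonical form, compression and feedback gains

The state dimension is `p + 1`, so every positive dimension is covered. -/

/-- The companion matrix of the Brunovsky canonical form, with last row `a`. -/
def sysA {p : ℕ} (a : Fin (p + 1) → ℝ) : Matrix (Fin (p + 1)) (Fin (p + 1)) ℝ :=
  Matrix.of fun k l =>
    if k = Fin.last p then a l else if (l : ℕ) = (k : ℕ) + 1 then 1 else 0

/-- The input vector `[0, …, 0, 1]` of the Brunovsky canonical form. -/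
def sysB (p : ℕ) : Fin (p + 1) → ℝ := Pi.single (Fin.last p) 1

/-- The compression row vector `K₂ = [b₁, …, bₙ₋₁, 1]`. -/
def gainK2 {p : ℕ} (b : Fin p → ℝ) : Fin (p + 1) → ℝ := Fin.snoc b 1

/-- The feedback row vector
`K₁ = [-a₁ + b₁, -a₂ + b₂ - b₁, …, -aₙ₋₁ + bₙ₋₁ - bₙ₋₂, -aₙ - bₙ₋₁ + 1]`. -/
def gainK1 {p : ℕ} (a : Fin (p + 1) → ℝ) (b : Fin p → ℝ) : Fin (p + 1) → ℝ :=
  fun k => -a k + gainK2 b k - (Fin.cons 0 b : Fin (p + 1) → ℝ) k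

/-- The compression encoding `g(x) = K₂ x`. -/
def compress {p : ℕ} (b : Fin p → ℝ) (x : Fin (p + 1) → ℝ) : ℝ := gainK2 b ⬝ᵥ x

/-- The average state `x̄ = (1/N) ∑ᵢ xᵢ`. -/
noncomputable def average {p N : ℕ} (x : Fin N → Fin (p + 1) → ℝ) : Fin (p + 1) → ℝ :=
  (1 / (N : ℝ)) • ∑ i, x i

/-! ### Noise distribution, projection, one-bit quantizer -/

/-- The distribution function of `N(0, σ²)`. -/
noncomputable def noiseF (σ : ℝ≥0) (r : ℝ) : ℝ := cdf (gaussianReal 0 (σ ^ 2)) r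

/-- The density of `N(0, σ²)`. -/
noncomputable def noiseDensity (σ : ℝ≥0) (r : ℝ) : ℝ := gaussianPDFReal 0 (σ ^ 2) r

/-- The projection of `ζ` on `[-M, M]`. -/
noncomputable def proj (M ζ : ℝ) : ℝ := max (-M) (min ζ M)

/-- `proj M ζ` minimizes `|ζ - ξ|` over `|ξ| ≤ M`. -/
theorem proj_isMin {M : ℝ} (hM : 0 ≤ M) (ζ : ℝ) :
    |proj M ζ| ≤ M ∧ ∀ ξ : ℝ, |ξ| ≤ M → |ζ - proj M ζ| ≤ |ζ - ξ| := by
  unfold proj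
  refine ⟨abs_le.2 ⟨le_max_left _ _, max_le (by linarith) (min_le_right _ _)⟩, fun ξ hξ => ?_⟩
  obtain ⟨h1, h2⟩ := abs_le.1 hξ
  rcases le_total ζ M with h | h
  · rw [min_eq_left h]
    rcases le_total (-M) ζ with h' | h'
    · rw [max_eq_right h']; simp
    · rw [max_eq_left h', abs_of_nonpos (by linarith), abs_of_nonpos (by linarith)]; linarith
  · rw [min_eq_right h, max_eq_right (by linarith), abs_of_nonneg (by linarith),
      abs_of_nonneg (by linarith)]; linarith

/-- The indicator of `y ≤ c`. -/
noncomputable def oneBit (y c : ℝ) : ℝ := if y ≤ c then 1 else 0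

/-! ### Topologies

The topologies are undirected graphs without self-loops on the agents. -/

/-- The union `G'` of the topologies `G₁, …, G_h`. -/
def unionGraph {N h : ℕ} (G : Fin h → SimpleGraph (Fin N)) : SimpleGraph (Fin N) := ⨆ u, G u

open Classical in
/-- The neighbours of agent `i` in a topology. -/
noncomputable def nbrs {N : ℕ} (H : SimpleGraph (Fin N)) (i : Fin N) : Finset (Fin N) :=
  Finset.univ.filter fun j => H.Adj i j

/-- The ordered edges of the union topology; they index the estimates. -/
abbrev Edges {N h : ℕ} (G : Fin h → SimpleGraph (Fin N)) : Type :=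
  {e : Fin N × Fin N // (unionGraph G).Adj e.1 e.2}

noncomputable instance {N h : ℕ} (G : Fin h → SimpleGraph (Fin N)) : Fintype (Edges G) :=
  Fintype.ofFinite _

open Classical in
/-- The Laplacian of a topology. -/
noncomputable def laplacian {N : ℕ} (H : SimpleGraph (Fin N)) : Matrix (Fin N) (Fin N) ℝ :=
  H.lapMatrix ℝ

/-- The averaged Laplacian `Ľ = ∑ᵤ πᵤ Lᵤ`. -/
noncomputable def meanLaplacian {N h : ℕ} (G : Fin h → SimpleGraph (Fin N)) (π : Fin h → ℝ) :
    Matrix (Fin N) (Fin N) ℝ := ∑ u, π u • laplacian (G u)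

open Classical in
/-- The matrix `Wᵤ`: row `i` selects the edges `(i, j)` that are active in topology `u`. -/
noncomputable def matW {N h : ℕ} (G : Fin h → SimpleGraph (Fin N)) (u : Fin h) :
    Matrix (Fin N) (Edges G) ℝ :=
  Matrix.of fun i e => if e.1.1 = i ∧ (G u).Adj e.1.1 e.1.2 then 1 else 0

/-- The matrix `Q`: row `(i, j)` is the `j`-th unit vector. -/
def matQ {N h : ℕ} (G : Fin h → SimpleGraph (Fin N)) : Matrix (Edges G) (Fin N) ℝ :=
  Matrix.of fun e j => if e.1.2 = j then 1 else 0

/-- The centering matrix `J = I - (1/N) 1 1ᵀ`. -/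
noncomputable def matJ (N : ℕ) : Matrix (Fin N) (Fin N) ℝ :=
  1 - (1 / (N : ℝ)) • Matrix.of fun _ _ => 1

open scoped Matrix.Norms.L2Operator in
/-- The spectral norm `‖A‖ = sqrt (λ_max (Aᵀ A))`, i.e. the operator norm between Euclidean
spaces. -/
noncomputable def specNorm {m n : Type*} [Fintype m] [Fintype n] [DecidableEq n]
    (A : Matrix m n ℝ) : ℝ := ‖A‖

/-! ### The constants in the thresholds -/

open Classical in
/-- `λ_G = maxᵤ ‖T⁻¹ J Wᵤ‖²`. -/
noncomputable def lamG {N h : ℕ} (G : Fin h → SimpleGraph (Fin N))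
    (T : Matrix (Fin N) (Fin N) ℝ) : ℝ :=
  ⨆ u, specNorm (T⁻¹ * matJ N * matW G u) ^ 2

open Classical in
/-- `λ_QW = maxᵤ ‖Q Wᵤ‖²`. -/
noncomputable def lamQW {N h : ℕ} (G : Fin h → SimpleGraph (Fin N)) : ℝ :=
  ⨆ u, specNorm (matQ G * matW G u) ^ 2

/-- `λ_QL = maxᵤ ‖Q Lᵤ T‖²`. -/
noncomputable def lamQL {N h : ℕ} (G : Fin h → SimpleGraph (Fin N))
    (T : Matrix (Fin N) (Fin N) ℝ) : ℝ :=
  ⨆ u, specNorm (matQ G * laplacian (G u) * T) ^ 2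

/-- `α = 2 sqrt λ_QW + λ_QL λ₂ / λ_G`. -/
noncomputable def alpha {N h : ℕ} (G : Fin h → SimpleGraph (Fin N))
    (T : Matrix (Fin N) (Fin N) ℝ) (lam2 : ℝ) : ℝ :=
  2 * Real.sqrt (lamQW G) + lamQL G T * lam2 / lamG G T

/-- `f_M = min_{i,j} f(|c_{ij}| + M)`. -/
noncomputable def fMin {N : ℕ} (σ : ℝ≥0) (c : Fin N → Fin N → ℝ) (M : ℝ) : ℝ :=
  ⨅ e : Fin N × Fin N, noiseDensity σ (|c e.1 e.2| + M)

/-- `π_min = minᵤ πᵤ`. -/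
noncomputable def piMin {h : ℕ} (π : Fin h → ℝ) : ℝ := ⨅ u, π u

/-! ### The switching signal -/

/-- `m` is a homogeneous Markov chain with state space `Fin h` and transition matrix `P`. -/
structure IsMarkovChain {Ω : Type*} [MeasurableSpace Ω] (μ : Measure Ω) {h : ℕ}
    (P : Matrix (Fin h) (Fin h) ℝ) (m : ℕ → Ω → Fin h) : Prop where
  measurable : ∀ t, Measurable (m t)
  stochastic : P ∈ Matrix.rowStochastic ℝ (Fin h)
  markov : ∀ (t : ℕ) (v : ℕ → Fin h),
    μ.real {ω | ∀ s ≤ t + 1, m s ω = v s} =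
      μ.real {ω | ∀ s ≤ t, m s ω = v s} * P (v t) (v (t + 1))

/-! ### The noises -/

/-- The noises `d_{ij}(t)` are independent over `i, j, t` with common law `N(0, σ²)`. -/
structure IsGaussianNoise {Ω : Type*} [MeasurableSpace Ω] (μ : Measure Ω) {N : ℕ} (σ : ℝ≥0)
    (d : ℕ → Fin N → Fin N → Ω → ℝ) : Prop where
  measurable : ∀ t i j, Measurable (d t i j)
  law : ∀ t i j, μ.map (d t i j) = gaussianReal 0 (σ ^ 2)
  indep : iIndepFun (fun k : ℕ × Fin N × Fin N => d k.1 k.2.1 k.2.2) μ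

/-! ### The closed loop -/

/-- The control input
`uᵢ(t) = K₁ xᵢ(t) + γ/(t+1) ∑_{j ∈ Nᵢ} (ẑᵢⱼ(t) - K₂ xᵢ(t))`
computed from the states `x` and estimates `z` at time `t` in the current topology `H`. -/
noncomputable def control {p N : ℕ} (a : Fin (p + 1) → ℝ) (b : Fin p → ℝ) (γ : ℝ)
    (H : SimpleGraph (Fin N)) (t : ℕ) (x : Fin N → Fin (p + 1) → ℝ) (z : Fin N → Fin N → ℝ)
    (i : Fin N) : ℝ :=
  gainK1 a b ⬝ᵥ x i + γ / ((t : ℝ) + 1) * ∑ j ∈ nbrs H i, (z i j - compress b (x i))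

open Classical in
/-- The states `x` and the estimates `z` (`z t i j` is agent `i`'s estimate of the compressed state
of agent `j`, for `j` a neighbour of `i` in the union topology) are generated by the consensus
algorithm, started at time `t₀`, under the switching signal `m` and the noises `d`. -/
structure ClosedLoop {Ω : Type*} {p N h : ℕ} (a : Fin (p + 1) → ℝ) (b : Fin p → ℝ)
    (G : Fin h → SimpleGraph (Fin N)) (σ : ℝ≥0) (c : Fin N → Fin N → ℝ) (M β γ : ℝ) (t₀ : ℕ)
    (x₀ : Fin N → Fin (p + 1) → ℝ) (z₀ : Fin N → Fin N → ℝ)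
    (m : ℕ → Ω → Fin h) (d : ℕ → Fin N → Fin N → Ω → ℝ)
    (x : ℕ → Fin N → Ω → Fin (p + 1) → ℝ) (z : ℕ → Fin N → Fin N → Ω → ℝ) : Prop where
  init_x : ∀ i ω, x (t₀ + 1) i ω = x₀ i
  init_z : ∀ i j, (unionGraph G).Adj i j → ∀ ω, z t₀ i j ω = z₀ i j
  /-- An estimate moves only when its edge is active in the current topology. -/
  estimate : ∀ t, t₀ + 1 ≤ t → ∀ i j, (unionGraph G).Adj i j → ∀ ω,
    z t i j ω = proj M (z (t - 1) i j ω +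
      if (G (m t ω)).Adj i j then
        β / (t : ℝ) * (noiseF σ (c i j - z (t - 1) i j ω) -
          oneBit (compress b (x t j ω) + d t i j ω) (c i j))
      else 0)
  update : ∀ t, t₀ + 1 ≤ t → ∀ i ω,
    x (t + 1) i ω = sysA a *ᵥ x t i ω +
      control a b γ (G (m t ω)) t (fun k => x t k ω) (fun k l => z t k l ω) i • sysB p

end OneBitConsensus

/-!
The compressed states `yᵢ = K₂ xᵢ` satisfy a closed recursion: the gain `K₁` cancels the companion
dynamics, so that `yᵢ(t+1) = yᵢ(t) + γ/(t+1) ∑ⱼ (ẑᵢⱼ(t) - yᵢ(t))` (`compress_update`). The gain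
condition at the initial time makes this a convex combination, hence `|yᵢ|, |ẑᵢⱼ| ≤ M` throughout,
and all increments at time `t` are of order `1/t`. The proof is a Lyapunov argument for
`V = E ‖J y‖²` and `R = E ‖ε‖²`, where `εᵢⱼ = ẑᵢⱼ - yⱼ`. Up to `O(1/t²)`, one step changes them as
follows.

* `V` decreases by `2γ/(t+1) E[y · L_{m(t)} y]`, and the errors contribute a cross term, which the
  definition of `λ_G` bounds by `γ/(t+1) (λ₂ V + λ_G/λ₂ R)` (`disagreement_succ_le`).
* `R` decreases by `2β f_M/(t+1) ∑ₑ E[1{e active at t+1} εₑ²]`: the fresh Gaussian noise replaces the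
  one-bit observation by its distribution function, whose slope on the relevant range is at least
  `f_M`. The drift of `y` contributes at most `γ/(t+1) (α R + λ_G/λ₂ V)`
  (`integral_estError_succ_sq_le`, `neg_two_mul_sum_estError_mul_drift_le`).

The two decreasing terms depend on the current state of the chain, and have to be replaced by their
stationary means, `E[y · Ľ y] ≥ λ₂ V` and at least `π_min R`. For a bounded adapted process `Q` with
increments of order `1/t` and a function `g` of the chain, let `X` solve the Poisson equation
`X - P X = g - π g`. By the Markov property `E[Q(t) g(m(t))] - π g E[Q(t)]` equals
`E[Q(t) X(m(t))] - E[Q(t+1) X(m(t+1))]` up to `O(1/t)` (`IsSlow.averages`). Multiplied by a step size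
`1/t`, this telescoping term is absorbed by a correction of the Lyapunov function that vanishes like
`1/t`, and no aperiodicity of the chain is needed.

With `A = γ λ₂`, `B = γ λ_G/λ₂` and `D = 2β f_M π_min - γ α`, what remains is
`V' ≤ -A V + B R`, `R' ≤ -D R + B V` on the time scale `∑ 1/t`. The thresholds on `β` say exactly that
`(A - κ₀)(D - κ₀) > B²`, with `κ₀ = 0` for convergence and `κ₀ = 1` for the rate `1/t`. Then some
combination `p V + R` contracts by `1 - κ/(t+1)` with `κ > κ₀`, and so decays like `t^(-ρ)` for every
`ρ ≤ 1` below `κ` (`coupled_decay`, `decay_of_recursion`).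
-/

namespace OneBitConsensus

/-! ### Recursions driven by averaged coefficients -/

/-- A recursion `S (t + 1) ≤ (1 - κ / (t + 1)) S t` perturbed by a telescoping term of order `1 / t`
and an error of order `1 / t²` decays like `t ^ (-ρ)` for every `ρ ≤ 1` with `ρ < κ`: the
telescoping term is absorbed by passing to `S t + η t / t`. -/
theorem decay_of_recursion {S η : ℕ → ℝ} {κ ρ C K₀ : ℝ} {T₀ : ℕ} (hρ0 : 0 < ρ) (hρ1 : ρ ≤ 1)
    (hρκ : ρ < κ) (hη : ∀ t, |η t| ≤ K₀)
    (hS : ∀ t : ℕ, T₀ ≤ t → S (t + 1) ≤ (1 - κ / (t + 1)) * S t + (η t - η (t + 1)) / (t + 1)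
      + C / (t + 1) ^ 2) :
    ∃ K : ℝ, ∀ᶠ t : ℕ in atTop, S t ≤ K * (t : ℝ) ^ (-ρ) := by
  have hK₀ : 0 ≤ K₀ := (abs_nonneg _).trans (hη 0)
  set u : ℕ → ℝ := fun t => S t + η t / t with hu
  set C₁ : ℝ := K₀ * |κ - 1| + |C| with hC₁
  have hC₁0 : 0 ≤ C₁ := by positivity
  have hstep : ∀ t : ℕ, T₀ ≤ t → 1 ≤ t →
      u (t + 1) ≤ (1 - κ / (t + 1)) * u t + C₁ / (t * (t + 1)) := by
    intro t ht ht1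
    have ht0 : (0 : ℝ) < t := by exact_mod_cast ht1
    have h1 := hS t ht
    have h2 : η t * (κ - 1) ≤ K₀ * |κ - 1| := by
      refine (le_abs_self _).trans ?_
      rw [abs_mul]
      exact mul_le_mul_of_nonneg_right (hη t) (abs_nonneg _)
    have h3 : C / ((t : ℝ) + 1) ^ 2 ≤ |C| / (t * (t + 1)) := by
      refine (div_le_div_of_nonneg_right (le_abs_self C) (by positivity)).trans ?_
      exact div_le_div_of_nonneg_left (abs_nonneg _) (by positivity) (by nlinarith)
    have h4 : η t * (κ - 1) / (t * (t + 1)) ≤ K₀ * |κ - 1| / ((t : ℝ) * (t + 1)) :=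
      div_le_div_of_nonneg_right h2 (by positivity)
    have h5 : u (t + 1) = S (t + 1) + η (t + 1) / (t + 1) := by simp [hu]
    have h6 : (1 - κ / ((t : ℝ) + 1)) * u t = (1 - κ / (t + 1)) * S t + η t / (t + 1)
        - η t * (κ - 1) / (t * (t + 1)) := by
      simp only [hu]; field_simp; ring
    rw [h5, h6, hC₁, add_div]
    rw [sub_div] at h1
    linarith
  obtain ⟨T₁, hT₁⟩ := exists_nat_ge (max (2 * ρ / (κ - ρ)) κ)
  set T : ℕ := max (max T₀ 1) T₁ with hT
  set K : ℝ := max (u T * (T : ℝ) ^ ρ) (2 * C₁ / (κ - ρ)) with hK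
  have hκρ : 0 < κ - ρ := by linarith
  have hK0 : 0 ≤ K := le_trans (by positivity) (le_max_right _ _)
  have hmain : ∀ t : ℕ, T ≤ t → u t ≤ K * (t : ℝ) ^ (-ρ) := by
    intro t ht
    induction t, ht using Nat.le_induction with
    | base =>
      have hTpos : (0 : ℝ) < T := by
        have : 1 ≤ T := (le_max_right _ _).trans (le_max_left _ _)
        exact_mod_cast this
      rw [Real.rpow_neg hTpos.le, ← div_eq_mul_inv, le_div_iff₀ (by positivity)]
      exact le_max_left _ _
    | succ t ht ih =>
      have ht1 : 1 ≤ t := ((le_max_right _ _).trans (le_max_left _ _)).trans ht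
      have htT0 : T₀ ≤ t := ((le_max_left _ _).trans (le_max_left _ _)).trans ht
      have htpos : (0 : ℝ) < t := by exact_mod_cast ht1
      have htT1 : max (2 * ρ / (κ - ρ)) κ ≤ t :=
        hT₁.trans (by exact_mod_cast (le_max_right _ _).trans ht)
      have hκt : κ ≤ t := (le_max_right _ _).trans htT1
      have hρt : 2 * ρ ≤ t * (κ - ρ) := by
        have := (le_max_left _ _).trans htT1
        rwa [div_le_iff₀ hκρ] at this
      set w : ℝ := (t : ℝ) ^ (-ρ) with hw
      have hw0 : 0 < w := by positivity
      -- Bernoulli: `(t + 1) ^ (-ρ)` is at least `t ^ (-ρ) * (1 - ρ / t)`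
      have hB : w * (1 - ρ / t) ≤ ((t + 1 : ℕ) : ℝ) ^ (-ρ) := by
        have e1 : ((t + 1 : ℕ) : ℝ) = t * (1 + 1 / t) := by
          push_cast; field_simp
        have e2 : (1 + 1 / (t : ℝ)) ^ ρ ≤ 1 + ρ * (1 / t) :=
          rpow_one_add_le_one_add_mul_self (by
            have : (0 : ℝ) ≤ 1 / t := by positivity
            linarith) hρ0.le hρ1
        rw [e1, Real.mul_rpow htpos.le (by positivity)]
        refine mul_le_mul_of_nonneg_left ?_ hw0.le
        rw [Real.rpow_neg (by positivity), ← one_div, le_div_iff₀ (by positivity)]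
        have e3 : 0 ≤ 1 - ρ / t := by
          rw [sub_nonneg, div_le_one htpos]; linarith
        calc (1 - ρ / t) * (1 + 1 / (t : ℝ)) ^ ρ ≤ (1 - ρ / t) * (1 + ρ * (1 / t)) :=
              mul_le_mul_of_nonneg_left e2 e3
          _ = 1 - (ρ / t) ^ 2 := by ring
          _ ≤ 1 := by linarith [sq_nonneg (ρ / (t : ℝ))]
      have hC : C₁ / (t * (t + 1)) ≤ K * w * ((κ - ρ) / (2 * (t + 1))) := by
        have e1 : C₁ ≤ K * ((κ - ρ) / 2) := by
          have : 2 * C₁ / (κ - ρ) ≤ K := le_max_right _ _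
          rw [div_le_iff₀ hκρ] at this
          linarith
        have e2 : (t : ℝ)⁻¹ ≤ w := by
          rw [hw, ← Real.rpow_neg_one]
          exact Real.rpow_le_rpow_of_exponent_le (by exact_mod_cast ht1) (by linarith)
        calc C₁ / (t * (t + 1)) = C₁ * (t : ℝ)⁻¹ / (t + 1) := by field_simp
          _ ≤ K * ((κ - ρ) / 2) * w / (t + 1) := by gcongr
          _ = K * w * ((κ - ρ) / (2 * (t + 1))) := by field_simp
      have hcoef : 1 - κ / (t + 1) + (κ - ρ) / (2 * (t + 1)) ≤ 1 - ρ / t := by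
        have : ρ / t ≤ (κ + ρ) / (2 * (t + 1)) := by
          rw [div_le_div_iff₀ htpos (by positivity)]
          nlinarith
        have e : κ / ((t : ℝ) + 1) - (κ - ρ) / (2 * (t + 1)) = (κ + ρ) / (2 * (t + 1)) := by
          field_simp; ring
        linarith
      have hc0 : 0 ≤ 1 - κ / ((t : ℝ) + 1) := by
        rw [sub_nonneg, div_le_one (by positivity)]; linarith
      calc u (t + 1) ≤ (1 - κ / (t + 1)) * u t + C₁ / (t * (t + 1)) := hstep t htT0 ht1
        _ ≤ (1 - κ / (t + 1)) * (K * w) + K * w * ((κ - ρ) / (2 * (t + 1))) :=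
            add_le_add (mul_le_mul_of_nonneg_left ih hc0) hC
        _ = K * w * (1 - κ / (t + 1) + (κ - ρ) / (2 * (t + 1))) := by ring
        _ ≤ K * w * (1 - ρ / t) := mul_le_mul_of_nonneg_left hcoef (by positivity)
        _ = K * (w * (1 - ρ / t)) := by ring
        _ ≤ _ := mul_le_mul_of_nonneg_left hB hK0
  refine ⟨K + K₀, ?_⟩
  filter_upwards [eventually_ge_atTop T] with t ht
  have ht1 : 1 ≤ t := ((le_max_right _ _).trans (le_max_left _ _)).trans ht
  have htpos : (0 : ℝ) < t := by exact_mod_cast ht1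
  have h1 := hmain t ht
  have h2 : -(η t / t) ≤ K₀ * (t : ℝ) ^ (-ρ) := by
    calc -(η t / t) = (-η t) * (t : ℝ)⁻¹ := by ring
      _ ≤ K₀ * (t : ℝ)⁻¹ :=
          mul_le_mul_of_nonneg_right ((neg_le_abs _).trans (hη t)) (by positivity)
      _ ≤ K₀ * (t : ℝ) ^ (-ρ) := by
          refine mul_le_mul_of_nonneg_left ?_ hK₀
          rw [← Real.rpow_neg_one]
          exact Real.rpow_le_rpow_of_exponent_le (by exact_mod_cast ht1) (by linarith)
  have h3 : u t = S t + η t / t := rfl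
  linarith

/-- The sequences `a` and `b` differ, from time `T₀` on, by the increment of a bounded sequence up
to an error of order `1 / t`. Summed against step sizes `1 / t`, they are then interchangeable. -/
def Averages (T₀ : ℕ) (a b : ℕ → ℝ) : Prop :=
  ∃ (ξ : ℕ → ℝ) (C : ℝ), (∀ t, |ξ t| ≤ C) ∧
    ∀ t : ℕ, T₀ ≤ t → |a t - b t - (ξ t - ξ (t + 1))| ≤ C / (t + 1)

theorem Averages.zero (T₀ : ℕ) : Averages T₀ (fun _ => 0) (fun _ => 0) :=
  ⟨0, 0, by simp, by simp⟩

theorem Averages.of_abs_sub_le {T₀ : ℕ} {a b : ℕ → ℝ} {C : ℝ}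
    (h : ∀ t : ℕ, T₀ ≤ t → |a t - b t| ≤ C / (t + 1)) : Averages T₀ a b := by
  refine ⟨0, |C|, by simp, fun t ht => ?_⟩
  simpa using (h t ht).trans (div_le_div_of_nonneg_right (le_abs_self C) (by positivity))

theorem Averages.add {T₀ : ℕ} {a b a' b' : ℕ → ℝ} (h : Averages T₀ a b) (h' : Averages T₀ a' b') :
    Averages T₀ (fun t => a t + a' t) (fun t => b t + b' t) := by
  obtain ⟨ξ, C, hξ, h⟩ := h
  obtain ⟨ξ', C', hξ', h'⟩ := h'
  refine ⟨fun t => ξ t + ξ' t, C + C', fun t => (abs_add_le _ _).trans (add_le_add (hξ t) (hξ' t)),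
    fun t ht => ?_⟩
  rw [add_div]
  refine le_trans (le_of_eq ?_) ((abs_add_le _ _).trans (add_le_add (h t ht) (h' t ht)))
  congr 1; ring

theorem Averages.const_mul {T₀ : ℕ} {a b : ℕ → ℝ} (k : ℝ) (h : Averages T₀ a b) :
    Averages T₀ (fun t => k * a t) (fun t => k * b t) := by
  obtain ⟨ξ, C, hξ, h⟩ := h
  refine ⟨fun t => k * ξ t, |k| * C, fun t => ?_, fun t ht => ?_⟩
  · rw [abs_mul]
    exact mul_le_mul_of_nonneg_left (hξ t) (abs_nonneg _)
  · rw [mul_div_assoc]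
    refine le_trans (le_of_eq ?_) (mul_le_mul_of_nonneg_left (h t ht) (abs_nonneg k))
    rw [← abs_mul]; congr 1; ring

theorem Averages.sum {ι : Type*} {T₀ : ℕ} (s : Finset ι) {a b : ι → ℕ → ℝ}
    (h : ∀ i, Averages T₀ (a i) (b i)) :
    Averages T₀ (fun t => ∑ i ∈ s, a i t) (fun t => ∑ i ∈ s, b i t) := by
  classical
  induction s using Finset.induction_on with
  | empty => simpa using Averages.zero T₀
  | insert i s hi ih =>
    simp only [Finset.sum_insert hi]
    exact (h i).add ih

theorem Averages.refl (T₀ : ℕ) (a : ℕ → ℝ) : Averages T₀ a a :=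
  Averages.of_abs_sub_le (C := 0) (by simp)

/-- A Lyapunov function for two coupled recursions: if `(A - κ₀) (D - κ₀) > B²`, then some
combination `p V + R` contracts at a rate `κ / t` with `κ > κ₀`. -/
theorem coupled_decay {V R a aV r rR : ℕ → ℝ} {A B D C κ₀ : ℝ} {T₀ : ℕ}
    (hV0 : ∀ t, 0 ≤ V t) (hR0 : ∀ t, 0 ≤ R t) (hB : 0 < B) (hA : κ₀ < A)
    (hdet : B ^ 2 < (A - κ₀) * (D - κ₀))
    (hV : ∀ t : ℕ, T₀ ≤ t → V (t + 1) ≤ V t + (B * R t - a t) / (t + 1) + C / (t + 1) ^ 2)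
    (hR : ∀ t : ℕ, T₀ ≤ t → R (t + 1) ≤ R t + (B * V t - r t) / (t + 1) + C / (t + 1) ^ 2)
    (ha : Averages T₀ a aV) (hr : Averages T₀ r rR)
    (haV : ∀ t, T₀ ≤ t → A * V t ≤ aV t) (hrR : ∀ t, T₀ ≤ t → D * R t ≤ rR t) :
    ∃ κ, κ₀ < κ ∧ ∀ ρ, 0 < ρ → ρ ≤ 1 → ρ < κ →
      ∃ K : ℝ, ∀ᶠ t : ℕ in atTop, V t ≤ K * (t : ℝ) ^ (-ρ) ∧ R t ≤ K * (t : ℝ) ^ (-ρ) := by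
  obtain ⟨ξ, C₁, hξ, ha⟩ := ha
  obtain ⟨ζ, C₂, hζ, hr⟩ := hr
  have hA' : 0 < A - κ₀ := by linarith
  have hlt : B / (A - κ₀) < (D - κ₀) / B := by
    rw [div_lt_div_iff₀ hA' hB]; linarith [sq B]
  obtain ⟨p, hp1, hp2⟩ := exists_between hlt
  have hp0 : 0 < p := (by positivity : 0 < B / (A - κ₀)).trans hp1
  rw [div_lt_iff₀ hA'] at hp1
  rw [lt_div_iff₀ hB] at hp2
  set κ : ℝ := κ₀ + min ((p * (A - κ₀) - B) / p) (D - κ₀ - p * B) with hκ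
  have hκ1 : κ₀ < κ := by
    have : 0 < min ((p * (A - κ₀) - B) / p) (D - κ₀ - p * B) :=
      lt_min (div_pos (by linarith) hp0) (by linarith)
    linarith
  have hκV : κ * p ≤ p * A - B := by
    have h1 : κ - κ₀ ≤ (p * (A - κ₀) - B) / p := by
      rw [hκ]; linarith [min_le_left ((p * (A - κ₀) - B) / p) (D - κ₀ - p * B)]
    rw [le_div_iff₀ hp0] at h1
    linarith
  have hκR : κ ≤ D - p * B := by
    have h1 : κ - κ₀ ≤ D - κ₀ - p * B := by
      rw [hκ]; linarith [min_le_right ((p * (A - κ₀) - B) / p) (D - κ₀ - p * B)]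
    linarith
  refine ⟨κ, hκ1, fun ρ hρ0 hρ1 hρκ => ?_⟩
  have hrec : ∀ t : ℕ, T₀ ≤ t → p * V (t + 1) + R (t + 1) ≤ (1 - κ / (t + 1)) * (p * V t + R t)
      + (-(p * ξ t + ζ t) - -(p * ξ (t + 1) + ζ (t + 1))) / (t + 1)
      + (p * C + C + p * C₁ + C₂) / (t + 1) ^ 2 := by
    intro t ht
    have htp : (0 : ℝ) < t + 1 := by positivity
    have h1 := mul_le_mul_of_nonneg_left (hV t ht) hp0.le
    have h2 := hR t ht
    have h3 : aV t + (ξ t - ξ (t + 1)) - C₁ / (t + 1) ≤ a t := by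
      linarith [(abs_le.1 (ha t ht)).1]
    have h4 : rR t + (ζ t - ζ (t + 1)) - C₂ / (t + 1) ≤ r t := by
      linarith [(abs_le.1 (hr t ht)).1]
    have h5 := haV t ht
    have h6 := hrR t ht
    have h7 : p * (B * R t - a t) + (B * V t - r t) ≤
        -κ * (p * V t + R t) + (-(p * ξ t + ζ t) - -(p * ξ (t + 1) + ζ (t + 1)))
          + (p * C₁ + C₂) / (t + 1) := by
      have e1 : p * (aV t + (ξ t - ξ (t + 1)) - C₁ / (t + 1)) ≤ p * a t :=
        mul_le_mul_of_nonneg_left h3 hp0.le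
      have e2 : p * (A * V t) ≤ p * aV t := mul_le_mul_of_nonneg_left h5 hp0.le
      have e3 : κ * p * V t ≤ (p * A - B) * V t := mul_le_mul_of_nonneg_right hκV (hV0 t)
      have e4 : κ * R t ≤ (D - p * B) * R t := mul_le_mul_of_nonneg_right hκR (hR0 t)
      have e5 : (p * C₁ + C₂) / ((t : ℝ) + 1) = p * (C₁ / (t + 1)) + C₂ / (t + 1) := by ring
      rw [e5]
      linarith
    have h8 := div_le_div_of_nonneg_right h7 htp.le
    calc p * V (t + 1) + R (t + 1)
        ≤ p * (V t + (B * R t - a t) / (t + 1) + C / (t + 1) ^ 2)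
          + (R t + (B * V t - r t) / (t + 1) + C / (t + 1) ^ 2) := add_le_add h1 h2
      _ = p * V t + R t + (p * (B * R t - a t) + (B * V t - r t)) / (t + 1)
          + (p * C + C) / (t + 1) ^ 2 := by ring
      _ ≤ p * V t + R t + (-κ * (p * V t + R t)
          + (-(p * ξ t + ζ t) - -(p * ξ (t + 1) + ζ (t + 1))) + (p * C₁ + C₂) / (t + 1)) / (t + 1)
          + (p * C + C) / (t + 1) ^ 2 := by gcongr
      _ = _ := by field_simp; ring
  have hη : ∀ t, |-(p * ξ t + ζ t)| ≤ p * C₁ + C₂ := fun t => by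
    rw [abs_neg]
    refine (abs_add_le _ _).trans (add_le_add ?_ (hζ t))
    rw [abs_mul, abs_of_pos hp0]
    exact mul_le_mul_of_nonneg_left (hξ t) hp0.le
  obtain ⟨K, hK⟩ := decay_of_recursion (S := fun t => p * V t + R t)
    (η := fun t => -(p * ξ t + ζ t)) hρ0 hρ1 hρκ hη hrec
  refine ⟨max (K / p) K, ?_⟩
  filter_upwards [hK] with t ht
  have hw : 0 ≤ (t : ℝ) ^ (-ρ) := by positivity
  constructor
  · refine le_trans ?_ (mul_le_mul_of_nonneg_right (le_max_left _ _) hw)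
    rw [div_mul_eq_mul_div, le_div_iff₀ hp0]
    linarith [hR0 t]
  · refine le_trans ?_ (mul_le_mul_of_nonneg_right (le_max_right _ _) hw)
    linarith [mul_nonneg hp0.le (hV0 t)]

/-! ### Spectral estimates for the topologies -/

theorem real_dotProduct_self_nonneg {n : Type*} [Fintype n] (v : n → ℝ) : 0 ≤ v ⬝ᵥ v :=
  Finset.sum_nonneg fun i _ => mul_self_nonneg (v i)

theorem mulVec_dotProduct_self_le {m n : Type*} [Fintype m] [Fintype n] [DecidableEq n]
    (A : Matrix m n ℝ) (v : n → ℝ) : (A *ᵥ v) ⬝ᵥ (A *ᵥ v) ≤ specNorm A ^ 2 * (v ⬝ᵥ v) := by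
  have h := Matrix.l2_opNorm_mulVec A (WithLp.toLp 2 v)
  have h2 := pow_le_pow_left₀ (norm_nonneg _) h 2
  rw [mul_pow, EuclideanSpace.norm_sq_eq, EuclideanSpace.norm_sq_eq] at h2
  simpa [specNorm, dotProduct, sq] using h2

/-- The Cauchy–Schwarz inequality followed by the arithmetic-geometric mean inequality. -/
theorem two_mul_dotProduct_le {n : Type*} [Fintype n] {u v : n → ℝ} {a b : ℝ} (ha : 0 ≤ a)
    (hb : 0 ≤ b) (h : (u ⬝ᵥ u) * (v ⬝ᵥ v) ≤ a * b) : 2 * (u ⬝ᵥ v) ≤ a + b := by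
  have hcs : (u ⬝ᵥ v) ^ 2 ≤ (u ⬝ᵥ u) * (v ⬝ᵥ v) := by
    have := Finset.sum_mul_sq_le_sq_mul_sq Finset.univ u v
    simpa [dotProduct, sq] using this
  refine abs_le_of_sq_le_sq' ?_ (by positivity) |>.2
  nlinarith [sq_nonneg (a - b)]

theorem matJ_mulVec_apply {N : ℕ} (y : Fin N → ℝ) (i : Fin N) :
    (matJ N *ᵥ y) i = y i - (1 / (N : ℝ)) * ∑ k, y k := by
  rw [matJ, Matrix.sub_mulVec, Matrix.one_mulVec, Matrix.smul_mulVec]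
  simp [Matrix.mulVec, dotProduct]

theorem sum_matJ_mulVec {N : ℕ} (y : Fin N → ℝ) : ∑ i, (matJ N *ᵥ y) i = 0 := by
  rcases Nat.eq_zero_or_pos N with rfl | hN
  · simp
  · have : (N : ℝ) ≠ 0 := by positivity
    simp only [matJ_mulVec_apply, Finset.sum_sub_distrib, Finset.sum_const, Finset.card_univ,
      Fintype.card_fin, nsmul_eq_mul]
    field_simp
    ring

theorem matJ_dotProduct_matJ {N : ℕ} (y w : Fin N → ℝ) :
    (matJ N *ᵥ y) ⬝ᵥ (matJ N *ᵥ w) = (matJ N *ᵥ y) ⬝ᵥ w := by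
  simp only [dotProduct, matJ_mulVec_apply w, mul_sub, Finset.sum_sub_distrib, ← Finset.sum_mul,
    sum_matJ_mulVec, zero_mul, sub_zero]

theorem laplacian_mulVec_apply {N : ℕ} (H : SimpleGraph (Fin N)) (y : Fin N → ℝ) (i : Fin N) :
    (laplacian H *ᵥ y) i = ∑ j ∈ nbrs H i, (y i - y j) := by
  classical
  rw [laplacian, SimpleGraph.lapMatrix_mulVec_apply, Finset.sum_sub_distrib, Finset.sum_const,
    nsmul_eq_mul]
  have : nbrs H i = H.neighborFinset i := by
    ext j; simp [nbrs]
  rw [this]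
  rfl

theorem laplacian_mulVec_matJ {N : ℕ} (H : SimpleGraph (Fin N)) (y : Fin N → ℝ) :
    laplacian H *ᵥ (matJ N *ᵥ y) = laplacian H *ᵥ y := by
  ext i
  simp [laplacian_mulVec_apply, matJ_mulVec_apply]

theorem dotProduct_laplacian_comm {N : ℕ} (H : SimpleGraph (Fin N)) (y w : Fin N → ℝ) :
    y ⬝ᵥ (laplacian H *ᵥ w) = w ⬝ᵥ (laplacian H *ᵥ y) := by
  classical
  have hs : (laplacian H)ᵀ = laplacian H :=
    SimpleGraph.isSymm_lapMatrix (R := ℝ) H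
  rw [Matrix.dotProduct_mulVec, ← Matrix.mulVec_transpose, hs, dotProduct_comm]

theorem matJ_dotProduct_laplacian {N : ℕ} (H : SimpleGraph (Fin N)) (y : Fin N → ℝ) :
    (matJ N *ᵥ y) ⬝ᵥ (laplacian H *ᵥ y) = y ⬝ᵥ (laplacian H *ᵥ y) := by
  rw [dotProduct_laplacian_comm, laplacian_mulVec_matJ]

theorem dotProduct_laplacian_nonneg {N : ℕ} (H : SimpleGraph (Fin N)) (y : Fin N → ℝ) :
    0 ≤ y ⬝ᵥ (laplacian H *ᵥ y) := by
  classical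
  have := (SimpleGraph.posSemidef_lapMatrix ℝ H).dotProduct_mulVec_nonneg y
  rw [star_trivial] at this
  unfold laplacian
  convert this

theorem eq_of_dotProduct_laplacian_eq_zero {N : ℕ} {H : SimpleGraph (Fin N)} {y : Fin N → ℝ}
    (hy : y ⬝ᵥ (laplacian H *ᵥ y) = 0) {i j : Fin N} (hij : H.Adj i j) : y i = y j := by
  classical
  refine (SimpleGraph.lapMatrix_toLinearMap₂'_apply'_eq_zero_iff_forall_adj ℝ H y).1 ?_ i j hij
  rw [Matrix.toLinearMap₂'_apply']
  unfold laplacian at hy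
  convert hy

theorem dotProduct_meanLaplacian {N h : ℕ} (G : Fin h → SimpleGraph (Fin N)) (π : Fin h → ℝ)
    (y : Fin N → ℝ) :
    y ⬝ᵥ (meanLaplacian G π *ᵥ y) = ∑ u, π u * (y ⬝ᵥ (laplacian (G u) *ᵥ y)) := by
  simp [meanLaplacian, Matrix.sum_mulVec, dotProduct_sum, Matrix.smul_mulVec]

/-- Joint connectedness: the kernel of the averaged Laplacian consists of the constants. -/
theorem eq_of_meanLaplacian_mulVec_eq_zero {N h : ℕ} {G : Fin h → SimpleGraph (Fin N)}
    (hG : (unionGraph G).Connected) {π : Fin h → ℝ} (hπ : ∀ u, 0 < π u) {y : Fin N → ℝ}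
    (hy : meanLaplacian G π *ᵥ y = 0) (i j : Fin N) : y i = y j := by
  have h0 : ∑ u, π u * (y ⬝ᵥ (laplacian (G u) *ᵥ y)) = 0 := by
    rw [← dotProduct_meanLaplacian, hy, dotProduct_zero]
  have h1 : ∀ u, y ⬝ᵥ (laplacian (G u) *ᵥ y) = 0 := by
    intro u
    have := (Finset.sum_eq_zero_iff_of_nonneg fun u _ =>
      mul_nonneg (hπ u).le (dotProduct_laplacian_nonneg (G u) y)).1 h0 u (Finset.mem_univ u)
    exact (mul_eq_zero.1 this).resolve_left (hπ u).ne'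
  obtain ⟨w⟩ := hG.preconnected i j
  induction w with
  | nil => rfl
  | cons hadj _ ih =>
    rw [← ih]
    rw [unionGraph, SimpleGraph.iSup_adj] at hadj
    obtain ⟨u, hu⟩ := hadj
    exact eq_of_dotProduct_laplacian_eq_zero (h1 u) hu

theorem orthogonal_inv {N : ℕ} {T : Matrix (Fin N) (Fin N) ℝ}
    (hT : T ∈ Matrix.orthogonalGroup (Fin N) ℝ) : T⁻¹ = Tᵀ :=
  Matrix.inv_eq_right_inv ((Matrix.mem_orthogonalGroup_iff (Fin N) ℝ).1 hT)

theorem mul_inv_of_orthogonal {N : ℕ} {T : Matrix (Fin N) (Fin N) ℝ}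
    (hT : T ∈ Matrix.orthogonalGroup (Fin N) ℝ) : T * T⁻¹ = 1 := by
  rw [orthogonal_inv hT]
  exact (Matrix.mem_orthogonalGroup_iff (Fin N) ℝ).1 hT

theorem inv_mul_of_orthogonal {N : ℕ} {T : Matrix (Fin N) (Fin N) ℝ}
    (hT : T ∈ Matrix.orthogonalGroup (Fin N) ℝ) : T⁻¹ * T = 1 := by
  rw [orthogonal_inv hT]
  exact (Matrix.mem_orthogonalGroup_iff' (Fin N) ℝ).1 hT

theorem inv_dotProduct_inv_of_orthogonal {N : ℕ} {T : Matrix (Fin N) (Fin N) ℝ}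
    (hT : T ∈ Matrix.orthogonalGroup (Fin N) ℝ) (v w : Fin N → ℝ) :
    (T⁻¹ *ᵥ v) ⬝ᵥ (T⁻¹ *ᵥ w) = v ⬝ᵥ w := by
  rw [Matrix.dotProduct_mulVec, Matrix.vecMul_mulVec, orthogonal_inv hT]
  simp [(Matrix.mem_orthogonalGroup_iff (Fin N) ℝ).1 hT]

/-- The second eigenvalue of the averaged Laplacian is positive and bounds its quadratic form from
below on the disagreement vectors. -/
theorem lam_pos_and_le_dotProduct {N h : ℕ} (hN : 2 ≤ N) {G : Fin h → SimpleGraph (Fin N)}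
    (hG : (unionGraph G).Connected) {π : Fin h → ℝ} (hπ : ∀ u, 0 < π u)
    {T : Matrix (Fin N) (Fin N) ℝ} (hT : T ∈ Matrix.orthogonalGroup (Fin N) ℝ)
    {lam : Fin N → ℝ} (hlam : Monotone lam)
    (hdiag : T⁻¹ * meanLaplacian G π * T = Matrix.diagonal lam) :
    0 < lam ⟨1, hN⟩ ∧ ∀ y : Fin N → ℝ,
      lam ⟨1, hN⟩ * ((matJ N *ᵥ y) ⬝ᵥ (matJ N *ᵥ y)) ≤ y ⬝ᵥ (meanLaplacian G π *ᵥ y) := by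
  have hcol : ∀ v : Fin N → ℝ,
      meanLaplacian G π *ᵥ (T *ᵥ v) = T *ᵥ (fun k => lam k * v k) := by
    intro v
    have h1 : meanLaplacian G π * T = T * Matrix.diagonal lam := by
      rw [← hdiag, ← Matrix.mul_assoc, ← Matrix.mul_assoc, mul_inv_of_orthogonal hT,
        Matrix.one_mul]
    rw [Matrix.mulVec_mulVec, h1, ← Matrix.mulVec_mulVec]
    congr 1
    ext k
    simp [Matrix.mulVec_diagonal]
  have hTT : ∀ v : Fin N → ℝ, T *ᵥ (T⁻¹ *ᵥ v) = v := fun v => by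
    rw [Matrix.mulVec_mulVec, mul_inv_of_orthogonal hT, Matrix.one_mulVec]
  have hTT' : ∀ v : Fin N → ℝ, T⁻¹ *ᵥ (T *ᵥ v) = v := fun v => by
    rw [Matrix.mulVec_mulVec, inv_mul_of_orthogonal hT, Matrix.one_mulVec]
  have hquad : ∀ v : Fin N → ℝ,
      v ⬝ᵥ (meanLaplacian G π *ᵥ v) = ∑ k, lam k * ((T⁻¹ *ᵥ v) k) ^ 2 := by
    intro v
    conv_lhs => rw [← hTT v]
    rw [hcol, ← inv_dotProduct_inv_of_orthogonal hT, hTT', hTT']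
    exact Finset.sum_congr rfl fun k _ => by ring
  have hnn : ∀ k, 0 ≤ lam k := by
    intro k
    have h1 := hquad (T *ᵥ Pi.single k 1)
    rw [hTT'] at h1
    have h2 : 0 ≤ (T *ᵥ Pi.single k 1) ⬝ᵥ (meanLaplacian G π *ᵥ (T *ᵥ Pi.single k 1)) := by
      rw [dotProduct_meanLaplacian]
      exact Finset.sum_nonneg fun u _ => mul_nonneg (hπ u).le (dotProduct_laplacian_nonneg _ _)
    rw [h1] at h2
    simpa [Pi.single_apply] using h2
  -- the coordinates of the constant vector
  set q : Fin N → ℝ := T⁻¹ *ᵥ (fun _ => 1) with hq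
  have hTq : T *ᵥ q = fun _ => 1 := hTT _
  have hlq : ∀ k, lam k * q k = 0 := by
    have h1 : meanLaplacian G π *ᵥ (fun _ => (1 : ℝ)) = 0 := by
      rw [meanLaplacian, Matrix.sum_mulVec]
      refine Finset.sum_eq_zero fun u _ => ?_
      rw [Matrix.smul_mulVec]
      have : laplacian (G u) *ᵥ (fun _ => (1 : ℝ)) = 0 := by
        ext i; simp [laplacian_mulVec_apply]
      rw [this, smul_zero]
    have h2 := hcol q
    rw [hTq, h1] at h2
    have h3 := hTT' (fun k => lam k * q k)
    rw [← h2, Matrix.mulVec_zero] at h3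
    exact fun k => (congrFun h3 k).symm
  have hpos : 0 < lam ⟨1, hN⟩ := by
    refine lt_of_le_of_ne (hnn _) fun h0 => ?_
    -- two orthonormal vectors in the kernel would both be constant
    have hl0 : lam ⟨0, by omega⟩ = 0 :=
      le_antisymm (h0 ▸ hlam (by simp [Fin.le_def])) (hnn _)
    have hker : ∀ k, lam k = 0 → meanLaplacian G π *ᵥ (T *ᵥ Pi.single k 1) = 0 := by
      intro k hk
      rw [hcol]
      have : (fun l => lam l * (Pi.single k 1 : Fin N → ℝ) l) = 0 := by
        ext l
        by_cases hl : l = k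
        · subst hl; simp [hk]
        · simp [hl]
      rw [this, Matrix.mulVec_zero]
    set v₀ : Fin N → ℝ := T *ᵥ Pi.single (⟨0, by omega⟩ : Fin N) 1 with hv₀
    set v₁ : Fin N → ℝ := T *ᵥ Pi.single (⟨1, hN⟩ : Fin N) 1 with hv₁
    have c0 := eq_of_meanLaplacian_mulVec_eq_zero hG hπ (hker _ hl0)
    have c1 := eq_of_meanLaplacian_mulVec_eq_zero hG hπ (hker _ h0.symm)
    have horth : v₀ ⬝ᵥ v₁ = 0 := by
      rw [← inv_dotProduct_inv_of_orthogonal hT, hTT', hTT']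
      simp
    have hn0 : v₀ ⬝ᵥ v₀ = 1 := by
      rw [← inv_dotProduct_inv_of_orthogonal hT, hTT']
      simp
    have hn1 : v₁ ⬝ᵥ v₁ = 1 := by
      rw [← inv_dotProduct_inv_of_orthogonal hT, hTT']
      simp
    let i₀ : Fin N := ⟨0, by omega⟩
    have e0 : v₀ = fun _ => v₀ i₀ := funext fun i => c0 i i₀
    have e1 : v₁ = fun _ => v₁ i₀ := funext fun i => c1 i i₀
    rw [e0, e1] at horth
    rw [e0] at hn0
    rw [e1] at hn1
    simp only [dotProduct, Finset.sum_const, Finset.card_univ, Fintype.card_fin, nsmul_eq_mul]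
      at horth hn0 hn1
    have : (N * (v₀ i₀ * v₁ i₀)) ^ 2 = (N * (v₀ i₀ * v₀ i₀)) * (N * (v₁ i₀ * v₁ i₀)) := by ring
    rw [horth, hn0, hn1] at this
    norm_num at this
  refine ⟨hpos, fun y => ?_⟩
  set w : Fin N → ℝ := matJ N *ᵥ y with hw
  have hyw : y ⬝ᵥ (meanLaplacian G π *ᵥ y) = w ⬝ᵥ (meanLaplacian G π *ᵥ w) := by
    simp only [dotProduct_meanLaplacian, hw, laplacian_mulVec_matJ, matJ_dotProduct_laplacian]
  rw [hyw, hquad, ← inv_dotProduct_inv_of_orthogonal hT]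
  set r : Fin N → ℝ := T⁻¹ *ᵥ w with hr
  have hlpos : ∀ k : Fin N, k ≠ ⟨0, by omega⟩ → lam ⟨1, hN⟩ ≤ lam k := by
    intro k hk
    refine hlam ?_
    rw [Fin.le_def]
    have : (k : ℕ) ≠ 0 := fun h => hk (Fin.ext h)
    show 1 ≤ (k : ℕ)
    omega
  -- disagreement vectors have no component along the constant eigenvector
  have hr0 : r ⟨0, by omega⟩ = 0 := by
    have hq0 : ∀ k : Fin N, k ≠ ⟨0, by omega⟩ → q k = 0 := fun k hk =>
      (mul_eq_zero.1 (hlq k)).resolve_left (hpos.trans_le (hlpos k hk)).ne'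
    have h1 : r ⬝ᵥ q = 0 := by
      rw [hr, hq, inv_dotProduct_inv_of_orthogonal hT]
      simpa [dotProduct] using sum_matJ_mulVec y
    have h2 : r ⬝ᵥ q = r ⟨0, by omega⟩ * q ⟨0, by omega⟩ := by
      refine Finset.sum_eq_single _ (fun k _ hk => by rw [hq0 k hk, mul_zero]) (by simp)
    have h3 : q ⟨0, by omega⟩ ≠ 0 := by
      intro h
      have h4 : q = 0 := by
        ext k
        by_cases hk : k = ⟨0, by omega⟩
        · rw [hk, h]; rfl
        · exact hq0 k hk
      have h5 := congrFun hTq ⟨0, by omega⟩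
      rw [h4, Matrix.mulVec_zero] at h5
      exact zero_ne_one h5
    rw [h2] at h1
    exact (mul_eq_zero.1 h1).resolve_right h3
  rw [dotProduct, Finset.mul_sum]
  refine Finset.sum_le_sum fun k _ => ?_
  by_cases hk : k = ⟨0, by omega⟩
  · rw [hk, hr0]; simp
  · rw [← sq]
    exact mul_le_mul_of_nonneg_right (hlpos k hk) (sq_nonneg _)

theorem matQ_mulVec_apply {N h : ℕ} (G : Fin h → SimpleGraph (Fin N)) (w : Fin N → ℝ)
    (e : Edges G) : (matQ G *ᵥ w) e = w e.1.2 := by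
  simp [matQ, Matrix.mulVec, dotProduct]

theorem adj_unionGraph {N h : ℕ} {G : Fin h → SimpleGraph (Fin N)} {u : Fin h} {i j : Fin N}
    (hij : (G u).Adj i j) : (unionGraph G).Adj i j := by
  rw [unionGraph, SimpleGraph.iSup_adj]; exact ⟨u, hij⟩

open Classical in
theorem matW_mulVec_apply {N h : ℕ} (G : Fin h → SimpleGraph (Fin N)) (u : Fin h)
    (z : Fin N → Fin N → ℝ) (i : Fin N) :
    (matW G u *ᵥ fun e : Edges G => z e.1.1 e.1.2) i = ∑ j ∈ nbrs (G u) i, z i j := by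
  simp only [matW, Matrix.mulVec, dotProduct, Matrix.of_apply, ite_mul, one_mul, zero_mul]
  rw [← Finset.sum_filter]
  refine Finset.sum_bij (fun e _ => e.1.2) ?_ ?_ ?_ ?_
  · rintro ⟨⟨k, j⟩, hkj⟩ he
    simp only [Finset.mem_filter, Finset.mem_univ, true_and] at he
    simpa [nbrs, ← he.1] using he.2
  · rintro ⟨⟨k, j⟩, hkj⟩ he ⟨⟨k', j'⟩, hkj'⟩ he' hjj
    simp only [Finset.mem_filter, Finset.mem_univ, true_and] at he he'
    ext <;> simp_all
  · intro j hj
    simp only [nbrs, Finset.mem_filter, Finset.mem_univ, true_and] at hj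
    exact ⟨⟨(i, j), adj_unionGraph hj⟩, by simpa using hj, rfl⟩
  · rintro ⟨⟨k, j⟩, hkj⟩ he
    simp only [Finset.mem_filter, Finset.mem_univ, true_and] at he
    rw [← he.1]

theorem lamG_pos {N h : ℕ} (hN : 2 ≤ N) {G : Fin h → SimpleGraph (Fin N)}
    (hG : (unionGraph G).Connected) {T : Matrix (Fin N) (Fin N) ℝ}
    (hT : T ∈ Matrix.orthogonalGroup (Fin N) ℝ) : 0 < lamG G T := by
  classical
  have : Nontrivial (Fin N) := Fin.nontrivial_iff_two_le.2 hN
  obtain ⟨i, j, hij⟩ : ∃ i j, (unionGraph G).Adj i j :=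
    ⟨⟨0, by omega⟩, hG.preconnected.exists_adj_of_nontrivial _⟩
  obtain ⟨u, hu⟩ : ∃ u, (G u).Adj i j := by
    rwa [unionGraph, SimpleGraph.iSup_adj] at hij
  let e : Edges G := ⟨(i, j), hij⟩
  have h1 := mulVec_dotProduct_self_le (T⁻¹ * matJ N * matW G u) (Pi.single e 1)
  have hW : matW G u *ᵥ (Pi.single e 1) = Pi.single i 1 := by
    ext k
    simp [matW, e, hu, Pi.single_apply, eq_comm]
  rw [← Matrix.mulVec_mulVec, hW, ← Matrix.mulVec_mulVec, inv_dotProduct_inv_of_orthogonal hT]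
    at h1
  have h2 : 0 < (matJ N *ᵥ Pi.single i 1) ⬝ᵥ (matJ N *ᵥ Pi.single i 1) := by
    rw [matJ_dotProduct_matJ]
    simp only [dotProduct_single, matJ_mulVec_apply, Pi.single_eq_same, mul_one,
      Finset.sum_pi_single', Finset.mem_univ, if_true]
    have : (1 : ℝ) < N := by exact_mod_cast hN
    rw [sub_pos, div_lt_one (by linarith)]
    exact this
  have h3 : specNorm (T⁻¹ * matJ N * matW G u) ^ 2 ≤ lamG G T :=
    le_ciSup (f := fun u => specNorm (T⁻¹ * matJ N * matW G u) ^ 2)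
      (Set.finite_range _).bddAbove u
  refine lt_of_lt_of_le h2 (h1.trans ?_)
  simpa using h3

/-- The cross term in the recursion of the disagreement. -/
theorem two_mul_matJ_dotProduct_matW_le {N h : ℕ} {G : Fin h → SimpleGraph (Fin N)}
    {T : Matrix (Fin N) (Fin N) ℝ} (hT : T ∈ Matrix.orthogonalGroup (Fin N) ℝ)
    {lam2 : ℝ} (hlam2 : 0 < lam2) (u : Fin h) (y : Fin N → ℝ) (ε : Edges G → ℝ) :
    2 * ((matJ N *ᵥ y) ⬝ᵥ (matW G u *ᵥ ε)) ≤
      lam2 * ((matJ N *ᵥ y) ⬝ᵥ (matJ N *ᵥ y)) + lamG G T / lam2 * (ε ⬝ᵥ ε) := by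
  classical
  have hlG : specNorm (T⁻¹ * matJ N * matW G u) ^ 2 ≤ lamG G T :=
    le_ciSup (f := fun u => specNorm (T⁻¹ * matJ N * matW G u) ^ 2)
      (Set.finite_range _).bddAbove u
  have hlG0 : 0 ≤ lamG G T := (sq_nonneg _).trans hlG
  have hε := real_dotProduct_self_nonneg ε
  have hy := real_dotProduct_self_nonneg (matJ N *ᵥ y)
  rw [← matJ_dotProduct_matJ, ← inv_dotProduct_inv_of_orthogonal hT (matJ N *ᵥ y)]
  refine two_mul_dotProduct_le (by positivity) (by positivity) ?_
  have h1 := mulVec_dotProduct_self_le (T⁻¹ * matJ N * matW G u) ε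
  rw [← Matrix.mulVec_mulVec, ← Matrix.mulVec_mulVec] at h1
  rw [inv_dotProduct_inv_of_orthogonal hT (matJ N *ᵥ y)]
  have h2 : lam2 * ((matJ N *ᵥ y) ⬝ᵥ (matJ N *ᵥ y)) * (lamG G T / lam2 * (ε ⬝ᵥ ε)) =
      ((matJ N *ᵥ y) ⬝ᵥ (matJ N *ᵥ y)) * (lamG G T * (ε ⬝ᵥ ε)) := by
    field_simp
  rw [h2]
  exact mul_le_mul_of_nonneg_left (h1.trans (mul_le_mul_of_nonneg_right hlG hε)) hy

/-- The cross term in the recursion of the estimation error. -/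
theorem neg_two_mul_dotProduct_matQ_le {N h : ℕ} {G : Fin h → SimpleGraph (Fin N)}
    {T : Matrix (Fin N) (Fin N) ℝ} (hT : T ∈ Matrix.orthogonalGroup (Fin N) ℝ)
    {lam2 : ℝ} (hlam2 : 0 < lam2) (hlG : 0 < lamG G T) (u : Fin h) (y : Fin N → ℝ)
    (ε : Edges G → ℝ) :
    -2 * (ε ⬝ᵥ (matQ G *ᵥ (matW G u *ᵥ ε - laplacian (G u) *ᵥ y))) ≤
      alpha G T lam2 * (ε ⬝ᵥ ε) + lamG G T / lam2 * ((matJ N *ᵥ y) ⬝ᵥ (matJ N *ᵥ y)) := by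
  classical
  have hQW : specNorm (matQ G * matW G u) ^ 2 ≤ lamQW G :=
    le_ciSup (f := fun u => specNorm (matQ G * matW G u) ^ 2)
      (Set.finite_range _).bddAbove u
  have hQL : specNorm (matQ G * laplacian (G u) * T) ^ 2 ≤ lamQL G T :=
    le_ciSup (f := fun u => specNorm (matQ G * laplacian (G u) * T) ^ 2)
      (Set.finite_range _).bddAbove u
  have hQW0 : 0 ≤ lamQW G := (sq_nonneg _).trans hQW
  have hQL0 : 0 ≤ lamQL G T := (sq_nonneg _).trans hQL
  have hε := real_dotProduct_self_nonneg ε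
  have hy := real_dotProduct_self_nonneg (matJ N *ᵥ y)
  have h1 : 2 * ((-ε) ⬝ᵥ (matQ G *ᵥ (matW G u *ᵥ ε))) ≤
      Real.sqrt (lamQW G) * (ε ⬝ᵥ ε) + Real.sqrt (lamQW G) * (ε ⬝ᵥ ε) := by
    refine two_mul_dotProduct_le (by positivity) (by positivity) ?_
    have h2 := mulVec_dotProduct_self_le (matQ G * matW G u) ε
    rw [← Matrix.mulVec_mulVec] at h2
    have h3 : Real.sqrt (lamQW G) * (ε ⬝ᵥ ε) * (Real.sqrt (lamQW G) * (ε ⬝ᵥ ε)) =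
        (ε ⬝ᵥ ε) * (lamQW G * (ε ⬝ᵥ ε)) := by
      rw [mul_mul_mul_comm, Real.mul_self_sqrt hQW0]; ring
    rw [h3, neg_dotProduct_neg]
    exact mul_le_mul_of_nonneg_left (h2.trans (mul_le_mul_of_nonneg_right hQW hε)) hε
  have h4 : 2 * (ε ⬝ᵥ (matQ G *ᵥ (laplacian (G u) *ᵥ y))) ≤
      lamQL G T * lam2 / lamG G T * (ε ⬝ᵥ ε)
        + lamG G T / lam2 * ((matJ N *ᵥ y) ⬝ᵥ (matJ N *ᵥ y)) := by
    refine two_mul_dotProduct_le (by positivity) (by positivity) ?_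
    have h2 := mulVec_dotProduct_self_le (matQ G * laplacian (G u) * T)
      (T⁻¹ *ᵥ (matJ N *ᵥ y))
    rw [← Matrix.mulVec_mulVec, Matrix.mulVec_mulVec _ T, mul_inv_of_orthogonal hT,
      Matrix.one_mulVec, inv_dotProduct_inv_of_orthogonal hT, ← Matrix.mulVec_mulVec,
      laplacian_mulVec_matJ] at h2
    have h3 : lamQL G T * lam2 / lamG G T * (ε ⬝ᵥ ε)
        * (lamG G T / lam2 * ((matJ N *ᵥ y) ⬝ᵥ (matJ N *ᵥ y))) =
        (ε ⬝ᵥ ε) * (lamQL G T * ((matJ N *ᵥ y) ⬝ᵥ (matJ N *ᵥ y))) := by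
      field_simp
    rw [h3]
    exact mul_le_mul_of_nonneg_left (h2.trans (mul_le_mul_of_nonneg_right hQL hy)) hε
  rw [Matrix.mulVec_sub, dotProduct_sub]
  rw [neg_dotProduct] at h1
  rw [alpha, add_mul]
  linarith

/-! ### The compressed dynamics -/

/-- The gain `K₁` cancels the companion dynamics: the compressed state is a first-order integrator
driven by the coupling term of the control. -/
theorem compress_update {p N : ℕ} (a : Fin (p + 1) → ℝ) (b : Fin p → ℝ) (γ : ℝ)
    (H : SimpleGraph (Fin N)) (t : ℕ) (x : Fin N → Fin (p + 1) → ℝ) (z : Fin N → Fin N → ℝ)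
    (i : Fin N) :
    compress b (sysA a *ᵥ x i + control a b γ H t x z i • sysB p) =
      compress b (x i) + γ / ((t : ℝ) + 1) * ∑ j ∈ nbrs H i, (z i j - compress b (x i)) := by
  have hB : gainK2 b ⬝ᵥ sysB p = 1 := by simp [sysB, gainK2]
  have hA : gainK2 b ᵥ* sysA a = a + (Fin.cons 0 b : Fin (p + 1) → ℝ) := by
    ext l
    rw [Matrix.vecMul, dotProduct, Fin.sum_univ_castSucc]
    simp only [gainK2, sysA, Matrix.of_apply, Fin.snoc_castSucc, Fin.snoc_last, if_true, one_mul,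
      Fin.castSucc_ne_last, if_false, Pi.add_apply, Fin.val_castSucc]
    rw [add_comm]
    congr 1
    refine Fin.cases ?_ (fun l => ?_) l
    · simp
    · simp only [Fin.val_succ, Fin.cons_succ, add_left_inj, mul_ite, mul_one, mul_zero]
      simp [← Fin.ext_iff]
  have hK : gainK1 a b = gainK2 b - (a + (Fin.cons 0 b : Fin (p + 1) → ℝ)) := by
    ext k
    simp [gainK1]
    ring
  have hc : ∀ v, compress b v = gainK2 b ⬝ᵥ v := fun _ => rfl
  rw [hc (_ + _), hc (x i), control, dotProduct_add, dotProduct_smul, hB, Matrix.dotProduct_mulVec, hA, hK, sub_dotProduct]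
  simp only [smul_eq_mul, hc]
  ring

theorem compress_average {p N : ℕ} (b : Fin p → ℝ) (x : Fin N → Fin (p + 1) → ℝ) :
    compress b (average x) = 1 / (N : ℝ) * ∑ i, compress b (x i) := by
  simp [compress, average, dotProduct_sum]

/-! ### The noise distribution -/

theorem noiseDensity_anti (σ : ℝ≥0) {x y : ℝ} (hxy : |x| ≤ |y|) :
    noiseDensity σ y ≤ noiseDensity σ x := by
  have h : x ^ 2 ≤ y ^ 2 := sq_le_sq.2 hxy
  simp only [noiseDensity, gaussianPDFReal, sub_zero]
  gcongr

theorem noiseF_sub {σ : ℝ≥0} (hσ : 0 < σ) {s r : ℝ} (hsr : s ≤ r) :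
    noiseF σ r - noiseF σ s = ∫ x in Set.Ioc s r, noiseDensity σ x := by
  have hv : σ ^ 2 ≠ 0 := (pow_pos hσ 2).ne'
  have h1 : (gaussianReal 0 (σ ^ 2)).real (Set.Ioc s r) = ∫ x in Set.Ioc s r, noiseDensity σ x := by
    rw [Measure.real, gaussianReal_apply_eq_integral 0 hv, ENNReal.toReal_ofReal]
    · rfl
    · exact integral_nonneg fun x => gaussianPDFReal_nonneg _ _ _
  rw [noiseF, noiseF, cdf_eq_real, cdf_eq_real, ← h1, ← Set.Iic_sdiff_Iic,
    measureReal_sdiff (Set.Iic_subset_Iic.2 hsr) measurableSet_Iic]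

theorem integrableOn_noiseDensity (σ : ℝ≥0) (s : Set ℝ) : IntegrableOn (noiseDensity σ) s :=
  (integrable_gaussianPDFReal 0 (σ ^ 2)).integrableOn

theorem le_noiseF_sub {σ : ℝ≥0} (hσ : 0 < σ) {s r k : ℝ} (hsr : s ≤ r) (hs : |s| ≤ k)
    (hr : |r| ≤ k) : noiseDensity σ k * (r - s) ≤ noiseF σ r - noiseF σ s := by
  rw [noiseF_sub hσ hsr]
  have h : ∫ _ in Set.Ioc s r, noiseDensity σ k ≤ ∫ x in Set.Ioc s r, noiseDensity σ x := by
    refine setIntegral_mono_on (by simp) (integrableOn_noiseDensity σ _) measurableSet_Ioc ?_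
    intro x hx
    refine noiseDensity_anti σ (le_trans ?_ (le_abs_self k))
    exact abs_le.2 ⟨by linarith [(abs_le.1 hs).1, hx.1], by linarith [(abs_le.1 hr).2, hx.2]⟩
  simpa [hsr, mul_comm] using h

theorem noiseF_sub_le {σ : ℝ≥0} (hσ : 0 < σ) {s r : ℝ} (hsr : s ≤ r) :
    noiseF σ r - noiseF σ s ≤ noiseDensity σ 0 * (r - s) := by
  rw [noiseF_sub hσ hsr]
  have h : ∫ x in Set.Ioc s r, noiseDensity σ x ≤ ∫ _ in Set.Ioc s r, noiseDensity σ 0 := by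
    refine setIntegral_mono_on (integrableOn_noiseDensity σ _) (by simp) measurableSet_Ioc ?_
    intro x _
    exact noiseDensity_anti σ (by simp)
  simpa [hsr, mul_comm] using h

theorem noiseF_mono (σ : ℝ≥0) : Monotone (noiseF σ) := monotone_cdf _

theorem noiseF_mem_Icc (σ : ℝ≥0) (r : ℝ) : 0 ≤ noiseF σ r ∧ noiseF σ r ≤ 1 :=
  ⟨cdf_nonneg _ _, cdf_le_one _ _⟩

theorem abs_noiseF_sub_le {σ : ℝ≥0} (hσ : 0 < σ) (s r : ℝ) :
    |noiseF σ r - noiseF σ s| ≤ noiseDensity σ 0 * |r - s| := by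
  rcases le_total s r with h | h
  · rw [abs_of_nonneg (sub_nonneg.2 (noiseF_mono σ h)), abs_of_nonneg (sub_nonneg.2 h)]
    exact noiseF_sub_le hσ h
  · rw [abs_sub_comm, abs_sub_comm r, abs_of_nonneg (sub_nonneg.2 (noiseF_mono σ h)),
      abs_of_nonneg (sub_nonneg.2 h)]
    exact noiseF_sub_le hσ h

theorem fMin_pos {N : ℕ} (hN : 0 < N) {σ : ℝ≥0} (hσ : 0 < σ) (c : Fin N → Fin N → ℝ) (M : ℝ) :
    0 < fMin σ c M := by
  have : Nonempty (Fin N) := ⟨⟨0, hN⟩⟩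
  obtain ⟨e, he⟩ := exists_eq_ciInf_of_finite
    (f := fun e : Fin N × Fin N => noiseDensity σ (|c e.1 e.2| + M))
  rw [fMin, ← he]
  exact gaussianPDFReal_pos _ _ _ (pow_pos hσ 2).ne'

/-- The expected correction of an estimate pulls it towards the compressed state, at a rate at
least `fMin`. -/
theorem mul_noiseF_sub_le {N : ℕ} {σ : ℝ≥0} (hσ : 0 < σ) (c : Fin N → Fin N → ℝ) {M : ℝ}
    (i j : Fin N) {y z : ℝ} (hy : |y| ≤ M) (hz : |z| ≤ M) :
    (z - y) * (noiseF σ (c i j - z) - noiseF σ (c i j - y)) ≤ -fMin σ c M * (z - y) ^ 2 := by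
  have hf : fMin σ c M ≤ noiseDensity σ (|c i j| + M) :=
    ciInf_le (f := fun e : Fin N × Fin N => noiseDensity σ (|c e.1 e.2| + M))
      (Set.finite_range _).bddBelow (i, j)
  have hb : ∀ w, |w| ≤ M → |c i j - w| ≤ |c i j| + M := fun w hw =>
    (abs_sub _ _).trans (by gcongr)
  have hsq : fMin σ c M * (z - y) ^ 2 ≤ noiseDensity σ (|c i j| + M) * (z - y) ^ 2 :=
    mul_le_mul_of_nonneg_right hf (sq_nonneg _)
  rcases le_total y z with h | h
  · have h1 := le_noiseF_sub hσ (s := c i j - z) (r := c i j - y) (by linarith) (hb z hz) (hb y hy)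
    have h2 := mul_le_mul_of_nonneg_left h1 (sub_nonneg.2 h)
    nlinarith
  · have h1 := le_noiseF_sub hσ (s := c i j - y) (r := c i j - z) (by linarith) (hb y hy) (hb z hz)
    have h2 := mul_le_mul_of_nonneg_left h1 (sub_nonneg.2 h)
    nlinarith

theorem measurable_oneBit (c : ℝ) : Measurable fun y => oneBit y c :=
  Measurable.ite measurableSet_Iic measurable_const measurable_const

theorem oneBit_mem_Icc (y c : ℝ) : 0 ≤ oneBit y c ∧ oneBit y c ≤ 1 := by
  unfold oneBit; split_ifs <;> simp

/-- Averaging the one-bit observation over a fresh noise. -/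
theorem integral_mul_oneBit {Ω : Type*} {mΩ : MeasurableSpace Ω} {μ : Measure Ω}
    [IsProbabilityMeasure μ] {σ : ℝ≥0} {φ Y W : Ω → ℝ} (hφ : Measurable φ) (hY : Measurable Y)
    (hW : Measurable W) (hlaw : μ.map W = gaussianReal 0 (σ ^ 2))
    (hind : IndepFun (fun ω => (φ ω, Y ω)) W μ) {C : ℝ} (hC : ∀ ω, |φ ω| ≤ C) (c : ℝ) :
    ∫ ω, φ ω * oneBit (Y ω + W ω) c ∂μ = ∫ ω, φ ω * noiseF σ (c - Y ω) ∂μ := by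
  have hφY : Measurable fun ω => (φ ω, Y ω) := hφ.prodMk hY
  have hmap := (indepFun_iff_map_prod_eq_prod_map_map hφY.aemeasurable hW.aemeasurable).1 hind
  rw [hlaw] at hmap
  set k : (ℝ × ℝ) × ℝ → ℝ := fun q => q.1.1 * oneBit (q.1.2 + q.2) c with hk
  have hkm : Measurable k := by
    refine (measurable_fst.comp measurable_fst).mul ((measurable_oneBit c).comp ?_)
    exact (measurable_snd.comp measurable_fst).add measurable_snd
  have hpair : Measurable fun ω => ((φ ω, Y ω), W ω) := hφY.prodMk hW
  have hint : Integrable (fun ω => φ ω * oneBit (Y ω + W ω) c) μ := by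
    refine Integrable.of_bound (hkm.comp hpair).aestronglyMeasurable (C * 1) (ae_of_all _ fun ω => ?_)
    rw [Real.norm_eq_abs, abs_mul]
    have h1 := oneBit_mem_Icc (Y ω + W ω) c
    rw [abs_of_nonneg h1.1]
    exact mul_le_mul (hC ω) h1.2 h1.1 ((abs_nonneg _).trans (hC ω))
  have h1 : ∫ ω, φ ω * oneBit (Y ω + W ω) c ∂μ = ∫ q, k q ∂(μ.map fun ω => ((φ ω, Y ω), W ω)) := by
    rw [integral_map hpair.aemeasurable hkm.aestronglyMeasurable]
  have hint' : Integrable k (μ.map fun ω => ((φ ω, Y ω), W ω)) := by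
    rw [integrable_map_measure hkm.aestronglyMeasurable hpair.aemeasurable]
    exact hint
  have := Measure.isProbabilityMeasure_map (μ := μ) hφY.aemeasurable
  rw [hmap] at h1 hint'
  rw [h1, integral_prod _ hint']
  have h2 : ∀ q : ℝ × ℝ, ∫ w, k (q, w) ∂(gaussianReal 0 (σ ^ 2)) = q.1 * noiseF σ (c - q.2) := by
    intro q
    have h3 : (fun w => k (q, w)) = fun w => q.1 * (Set.Iic (c - q.2)).indicator 1 w := by
      ext w
      simp only [hk, oneBit, Set.indicator, Set.mem_Iic, Pi.one_apply, le_sub_iff_add_le']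
    rw [h3, integral_const_mul, integral_indicator_one measurableSet_Iic, noiseF, cdf_eq_real]
  simp only [h2]
  have hFm : Measurable fun q : ℝ × ℝ => q.1 * noiseF σ (c - q.2) :=
    measurable_fst.mul ((noiseF_mono σ).measurable.comp (measurable_const.sub measurable_snd))
  rw [integral_map hφY.aemeasurable hFm.aestronglyMeasurable]

/-- If `X` is independent of the pair `(U, W)` and `U` of `W`, then `(X, U)` is independent of
`W`. -/
theorem indepFun_prodMk_of_indepFun {Ω α β δ : Type*} {mΩ : MeasurableSpace Ω} {μ : Measure Ω}
    [IsProbabilityMeasure μ] [MeasurableSpace α] [MeasurableSpace β] [MeasurableSpace δ]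
    {X : Ω → α} {U : Ω → β} {W : Ω → δ} (hX : Measurable X) (hU : Measurable U) (hW : Measurable W)
    (h1 : IndepFun X (fun ω => (U ω, W ω)) μ) (h2 : IndepFun U W μ) :
    IndepFun (fun ω => (X ω, U ω)) W μ := by
  have hXU : IndepFun X U μ := h1.comp measurable_id measurable_fst
  have e1 := (indepFun_iff_map_prod_eq_prod_map_map hX.aemeasurable
    (hU.prodMk hW).aemeasurable).1 h1
  have e2 := (indepFun_iff_map_prod_eq_prod_map_map hU.aemeasurable hW.aemeasurable).1 h2
  have e3 := (indepFun_iff_map_prod_eq_prod_map_map hX.aemeasurable hU.aemeasurable).1 hXU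
  refine (indepFun_iff_map_prod_eq_prod_map_map (hX.prodMk hU).aemeasurable hW.aemeasurable).2 ?_
  have := Measure.isProbabilityMeasure_map (μ := μ) hX.aemeasurable
  have := Measure.isProbabilityMeasure_map (μ := μ) hU.aemeasurable
  have := Measure.isProbabilityMeasure_map (μ := μ) hW.aemeasurable
  rw [e3]
  apply MeasurableEquiv.prodAssoc.map_measurableEquiv_injective
  rw [Measure.prodAssoc_prod, ← e2, ← e1, Measure.map_map MeasurableEquiv.prodAssoc.measurable
    ((hX.prodMk hU).prodMk hW)]
  rfl

/-! ### The switching signal -/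

/-- The information generated by the chain up to time `t` and by all of `D`. -/
@[reducible]
def pastSigma {Ω β : Type*} [MeasurableSpace β] {h : ℕ} (m : ℕ → Ω → Fin h) (D : Ω → β) (t : ℕ) :
    MeasurableSpace Ω :=
  MeasurableSpace.comap (fun ω => ((fun s : Fin (t + 1) => m s ω), D ω)) inferInstance

theorem pastSigma_le {Ω β : Type*} {mΩ : MeasurableSpace Ω} [MeasurableSpace β] {h : ℕ}
    {m : ℕ → Ω → Fin h} (hm : ∀ t, Measurable (m t)) {D : Ω → β} (hD : Measurable D) (t : ℕ) :
    pastSigma m D t ≤ mΩ :=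
  ((measurable_pi_lambda _ fun s : Fin (t + 1) => hm s).prodMk hD).comap_le

section MarkovChain

variable {Ω : Type*} {mΩ : MeasurableSpace Ω} {μ : Measure Ω} [IsProbabilityMeasure μ]
  {h : ℕ} {P : Matrix (Fin h) (Fin h) ℝ} {m : ℕ → Ω → Fin h}

theorem IsMarkovChain.integral_path_mul (hm : IsMarkovChain μ P m) (t : ℕ)
    (w : Fin (t + 1) → Fin h) (g : Fin h → ℝ) :
    ∫ ω, (if (fun s : Fin (t + 1) => m s ω) = w then g (m (t + 1) ω) else 0) ∂μ =
      ∫ ω, (if (fun s : Fin (t + 1) => m s ω) = w then (P *ᵥ g) (m t ω) else 0) ∂μ := by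
  have hX : Measurable fun ω => (fun s : Fin (t + 1) => m s ω) :=
    measurable_pi_lambda _ fun s => hm.measurable s
  have hset : MeasurableSet {ω | (fun s : Fin (t + 1) => m s ω) = w} :=
    hX (measurableSet_singleton w)
  have hiff : ∀ ω, (fun s : Fin (t + 1) => m s ω) = w ↔
      ∀ s ≤ t, m s ω = if hs : s < t + 1 then w ⟨s, hs⟩ else w 0 := by
    intro ω
    constructor
    · rintro hw s hs
      rw [dif_pos (Nat.lt_succ_of_le hs), ← hw]
    · intro hw
      funext s
      have := hw s (Nat.le_of_lt_succ s.2)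
      rwa [dif_pos s.2] at this
  have hstep : ∀ v : Fin h, μ.real {ω | (fun s : Fin (t + 1) => m s ω) = w ∧ m (t + 1) ω = v} =
      μ.real {ω | (fun s : Fin (t + 1) => m s ω) = w} * P (w (Fin.last t)) v := by
    intro v
    have := hm.markov t (fun s => if hs : s < t + 1 then w ⟨s, hs⟩ else v)
    rw [dif_neg (lt_irrefl _), dif_pos (Nat.lt_succ_self t)] at this
    convert this using 2
    · congr 1
      ext ω
      constructor
      · rintro ⟨h1, h2⟩ s hs
        rcases Nat.lt_or_ge s (t + 1) with hs' | hs'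
        · have := (hiff ω).1 h1 s (Nat.le_of_lt_succ hs')
          rw [dif_pos hs'] at this ⊢
          exact this
        · have : s = t + 1 := le_antisymm hs hs'
          subst this
          rw [dif_neg (lt_irrefl _)]
          exact h2
      · intro h1
        refine ⟨(hiff ω).2 fun s hs => ?_, ?_⟩
        · have := h1 s (hs.trans (Nat.le_succ t))
          rw [dif_pos (Nat.lt_succ_of_le hs)] at this ⊢
          exact this
        · have := h1 (t + 1) le_rfl
          rwa [dif_neg (lt_irrefl _)] at this
    · congr 1
      ext ω
      refine (hiff ω).trans (forall₂_congr fun s hs => ?_)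
      rw [dif_pos (Nat.lt_succ_of_le hs), dif_pos (Nat.lt_succ_of_le hs)]
    · rfl
  have e1 : (fun ω => if (fun s : Fin (t + 1) => m s ω) = w then g (m (t + 1) ω) else 0) =
      fun ω => ∑ v, g v *
        {ω | (fun s : Fin (t + 1) => m s ω) = w ∧ m (t + 1) ω = v}.indicator (fun _ => (1 : ℝ)) ω := by
    ext ω
    by_cases hw : (fun s : Fin (t + 1) => m s ω) = w
    · simp [Set.indicator, hw]
    · simp [Set.indicator, hw]
  have e2 : (fun ω => if (fun s : Fin (t + 1) => m s ω) = w then (P *ᵥ g) (m t ω) else 0) =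
      fun ω => (P *ᵥ g) (w (Fin.last t)) *
        {ω | (fun s : Fin (t + 1) => m s ω) = w}.indicator (fun _ => (1 : ℝ)) ω := by
    ext ω
    by_cases hw : (fun s : Fin (t + 1) => m s ω) = w
    · have : m t ω = w (Fin.last t) := congrFun hw (Fin.last t)
      simp [Set.indicator, hw, this]
    · simp [Set.indicator, hw]
  have hset' : ∀ v, MeasurableSet {ω | (fun s : Fin (t + 1) => m s ω) = w ∧ m (t + 1) ω = v} :=
    fun v => hset.inter (hm.measurable (t + 1) (measurableSet_singleton v))
  have hone : ∀ {s : Set Ω}, MeasurableSet s →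
      ∫ ω, s.indicator (fun _ => (1 : ℝ)) ω ∂μ = μ.real s := fun hs => integral_indicator_one hs
  rw [e1, e2, integral_const_mul, hone hset, integral_finsetSum]
  · simp only [integral_const_mul, hone (hset' _), hstep, Matrix.mulVec, dotProduct,
      Finset.sum_mul]
    exact Finset.sum_congr rfl fun v _ => by ring
  · exact fun v _ => ((integrable_const (1 : ℝ)).indicator (hset' v)).const_mul _

/-- The Markov property, with the additional information `D` independent of the chain. -/
theorem IsMarkovChain.integral_mul (hm : IsMarkovChain μ P m) {β : Type*} [MeasurableSpace β]
    {D : Ω → β} (hD : Measurable D) (hDm : IndepFun D (fun ω t => m t ω) μ) {t : ℕ} {Q : Ω → ℝ}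
    (hQ : Measurable[pastSigma m D t] Q) {C : ℝ} (hC : ∀ ω, |Q ω| ≤ C) (g : Fin h → ℝ) :
    ∫ ω, Q ω * g (m (t + 1) ω) ∂μ = ∫ ω, Q ω * (P *ᵥ g) (m t ω) ∂μ := by
  set X : Ω → Fin (t + 1) → Fin h := fun ω s => m s ω with hXdef
  have hX : Measurable X := measurable_pi_lambda _ fun s => hm.measurable s
  obtain ⟨q, hq, hQq⟩ := hQ.exists_eq_measurable_comp
  -- truncation makes each section of `q` bounded
  set r : (Fin (t + 1) → Fin h) → β → ℝ := fun w y => max (-C) (min (q (w, y)) C) with hr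
  have hrm : ∀ w, Measurable (r w) := fun w =>
    measurable_const.max ((hq.comp measurable_prodMk_left).min measurable_const)
  have hQr : ∀ ω, Q ω = r (X ω) (D ω) := by
    intro ω
    have h1 : Q ω = q (X ω, D ω) := congrFun hQq ω
    have h2 := abs_le.1 (hC ω)
    simp only [hr]
    rw [← h1, min_eq_left h2.2, max_eq_right h2.1]
  have hrb : ∀ w y, |r w y| ≤ |C| := by
    intro w y
    have h1 : -|C| ≤ r w y := (neg_le_neg (le_abs_self C)).trans (le_max_left _ _)
    refine abs_le.2 ⟨h1, max_le (neg_le_abs C) ((min_le_right _ _).trans (le_abs_self C))⟩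
  have key : ∀ k : (ℕ → Fin h) → ℝ, Measurable k → (∃ K, ∀ v, |k v| ≤ K) →
      ∫ ω, Q ω * k (fun s => m s ω) ∂μ = ∑ w, (∫ ω, r w (D ω) ∂μ) *
        ∫ ω, (if X ω = w then k (fun s => m s ω) else 0) ∂μ := by
    rintro k hk ⟨K, hK⟩
    have hpath : Measurable fun ω => (fun s => m s ω : ℕ → Fin h) :=
      measurable_pi_lambda _ hm.measurable
    have hkw : ∀ w : Fin (t + 1) → Fin h, Measurable fun v : ℕ → Fin h =>
        if (fun s : Fin (t + 1) => v s) = w then k v else 0 := fun w =>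
      Measurable.ite ((measurable_pi_lambda (fun (v : ℕ → Fin h) (s : Fin (t + 1)) => v s)
        fun s => measurable_pi_apply (s : ℕ)) (measurableSet_singleton w)) hk measurable_const
    have e : ∀ ω, Q ω * k (fun s => m s ω) =
        ∑ w, r w (D ω) * (if X ω = w then k (fun s => m s ω) else 0) := by
      intro ω
      simp [hQr ω]
    simp only [e]
    rw [integral_finsetSum]
    · refine Finset.sum_congr rfl fun w _ => ?_
      have hi : IndepFun (fun ω => r w (D ω)) (fun ω => if X ω = w then k (fun s => m s ω) else 0) μ :=
        hDm.comp (hrm w) (hkw w)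
      exact hi.integral_fun_mul_eq_mul_integral ((hrm w).comp hD).aestronglyMeasurable
        ((hkw w).comp hpath).aestronglyMeasurable
    · intro w _
      refine Integrable.of_bound (((hrm w).comp hD).mul ((hkw w).comp hpath)).aestronglyMeasurable
        (|C| * |K|) (ae_of_all _ fun ω => ?_)
      rw [Real.norm_eq_abs, abs_mul]
      refine mul_le_mul (hrb _ _) ?_ (abs_nonneg _) (abs_nonneg _)
      split_ifs
      · exact (hK _).trans (le_abs_self K)
      · simp
  have hb : ∀ g' : Fin h → ℝ, ∀ u, |g' u| ≤ ∑ v, |g' v| := fun g' u =>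
    Finset.single_le_sum (f := fun v => |g' v|) (fun v _ => abs_nonneg _) (Finset.mem_univ u)
  rw [key (fun v => g (v (t + 1))) ((measurable_of_finite g).comp (measurable_pi_apply _))
      ⟨_, fun v => hb g _⟩,
    key (fun v => (P *ᵥ g) (v t)) ((measurable_of_finite (P *ᵥ g)).comp (measurable_pi_apply _))
      ⟨_, fun v => hb (P *ᵥ g) _⟩]
  exact Finset.sum_congr rfl fun w _ => by rw [hm.integral_path_mul t w g]

theorem IsMarkovChain.measureReal_succ (hm : IsMarkovChain μ P m) (t : ℕ) (v : Fin h) :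
    μ.real {ω | m (t + 1) ω = v} = ∑ u, μ.real {ω | m t ω = u} * P u v := by
  have h1 := hm.integral_mul (D := fun _ => ()) measurable_const (indepFun_const_left _ _)
    (t := t) (Q := fun _ => 1) measurable_const (C := 1) (by simp) (Pi.single v 1)
  have hms : ∀ s u, MeasurableSet {ω | m s ω = u} := fun s u =>
    hm.measurable s (measurableSet_singleton u)
  have hone : ∀ {s : Set Ω}, MeasurableSet s →
      ∫ ω, s.indicator (fun _ => (1 : ℝ)) ω ∂μ = μ.real s := fun hs => integral_indicator_one hs
  have e1 : ∀ ω, (1 : ℝ) * (Pi.single v 1 : Fin h → ℝ) (m (t + 1) ω) =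
      {ω | m (t + 1) ω = v}.indicator (fun _ => (1 : ℝ)) ω := fun ω => by
    simp [Pi.single_apply, Set.indicator]
  have e2 : ∀ ω, (1 : ℝ) * (P *ᵥ Pi.single v 1) (m t ω) =
      ∑ u, {ω | m t ω = u}.indicator (fun _ => (1 : ℝ)) ω * P u v := fun ω => by
    simp [Set.indicator]
  simp only [e1, e2] at h1
  rw [hone (hms _ _), integral_finsetSum] at h1
  · simp only [integral_mul_const] at h1
    rw [h1]
    exact Finset.sum_congr rfl fun u _ => by rw [hone (hms _ _)]
  · exact fun u _ => ((integrable_const (1 : ℝ)).indicator (hms t u)).mul_const _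

variable {π : Fin h → ℝ}

theorem IsMarkovChain.sum_limit (hm : IsMarkovChain μ P m)
    (hπ : ∀ u, Tendsto (fun t => μ.real {ω | m t ω = u}) atTop (𝓝 (π u))) : ∑ u, π u = 1 := by
  have h1 : Tendsto (fun t => ∑ u, μ.real {ω | m t ω = u}) atTop (𝓝 (∑ u, π u)) :=
    tendsto_finsetSum _ fun u _ => hπ u
  have h2 : ∀ t, ∑ u, μ.real {ω | m t ω = u} = 1 := fun t => by
    have := sum_measureReal_preimage_singleton (μ := μ) (f := m t) Finset.univ
      fun u _ => hm.measurable t (measurableSet_singleton u)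
    simpa [Set.preimage] using this
  simp only [h2] at h1
  exact tendsto_nhds_unique h1 tendsto_const_nhds |>.symm ▸ rfl

theorem IsMarkovChain.limit_vecMul (hm : IsMarkovChain μ P m)
    (hπ : ∀ u, Tendsto (fun t => μ.real {ω | m t ω = u}) atTop (𝓝 (π u))) : π ᵥ* P = π := by
  ext v
  have h1 := (hπ v).comp (tendsto_add_atTop_nat 1)
  have h2 : Tendsto (fun t => ∑ u, μ.real {ω | m t ω = u} * P u v) atTop
      (𝓝 (∑ u, π u * P u v)) := tendsto_finsetSum _ fun u _ => (hπ u).mul_const _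
  refine tendsto_nhds_unique h2 (h1.congr fun t => ?_)
  exact hm.measureReal_succ t v

/-- The limit distribution of an irreducible chain charges every state. -/
theorem IsMarkovChain.limit_pos (hm : IsMarkovChain μ P m) (hP : P.IsIrreducible)
    (hπ : ∀ u, Tendsto (fun t => μ.real {ω | m t ω = u}) atTop (𝓝 (π u))) (v : Fin h) :
    0 < π v := by
  have hnn : ∀ u, 0 ≤ π u := fun u => ge_of_tendsto' (hπ u) fun t => measureReal_nonneg
  have hex : ∃ u, 0 < π u := by
    by_contra hcon
    push Not at hcon
    have : ∑ u, π u = 0 := Finset.sum_eq_zero fun u _ => le_antisymm (hcon u) (hnn u)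
    rw [hm.sum_limit hπ] at this
    exact one_ne_zero this
  obtain ⟨u, hu⟩ := hex
  obtain ⟨k, _, hk⟩ := (Matrix.isIrreducible_iff_exists_pow_pos hP.nonneg).1 hP u v
  have hpow : ∀ k : ℕ, π ᵥ* P ^ k = π := by
    intro k
    induction k with
    | zero => simp
    | succ k ih => rw [pow_succ, ← Matrix.vecMul_vecMul, ih, hm.limit_vecMul hπ]
  have h1 : π v = ∑ w, π w * (P ^ k) w v := (congrFun (hpow k) v).symm
  rw [h1]
  have hPk : ∀ w, 0 ≤ (P ^ k) w v := fun w =>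
    Matrix.nonneg_of_mem_rowStochastic (pow_mem hm.stochastic k)
  exact Finset.sum_pos' (fun w _ => mul_nonneg (hnn w) (hPk w))
    ⟨u, Finset.mem_univ u, mul_pos hu hk⟩

/-- The harmonic functions of an irreducible chain are constant (maximum principle). -/
theorem eq_of_mulVec_eq (hP : P.IsIrreducible) (hst : P ∈ Matrix.rowStochastic ℝ (Fin h))
    {X : Fin h → ℝ} (hX : P *ᵥ X = X) (u v : Fin h) : X u = X v := by
  have : Nonempty (Fin h) := ⟨u⟩
  obtain ⟨w, hw⟩ := Finite.exists_max X
  suffices H : ∀ v, X w = X v by rw [← H u, ← H v]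
  intro v
  obtain ⟨k, _, hk⟩ := (Matrix.isIrreducible_iff_exists_pow_pos hP.nonneg).1 hP w v
  have hpow : ∀ k : ℕ, P ^ k *ᵥ X = X := by
    intro k
    induction k with
    | zero => simp
    | succ k ih => rw [pow_succ, ← Matrix.mulVec_mulVec, hX, ih]
  have hPk := pow_mem hst k
  have h1 : ∑ l, (P ^ k) w l * (X w - X l) = 0 := by
    simp only [mul_sub, Finset.sum_sub_distrib, ← Finset.sum_mul]
    rw [Matrix.sum_row_of_mem_rowStochastic hPk, one_mul]
    have : ∑ l, (P ^ k) w l * X l = X w := congrFun (hpow k) w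
    rw [this, sub_self]
  have h2 := (Finset.sum_eq_zero_iff_of_nonneg fun l _ =>
    mul_nonneg (Matrix.nonneg_of_mem_rowStochastic hPk) (sub_nonneg.2 (hw l))).1 h1 v
    (Finset.mem_univ v)
  exact sub_eq_zero.1 ((mul_eq_zero.1 h2).resolve_left hk.ne')

/-- The Poisson equation of an irreducible chain. It is solvable since `X ↦ X - P X + (π ⬝ X) 1` is
injective, hence surjective. Periodic chains are covered. -/
theorem exists_poisson_solution (hP : P.IsIrreducible)
    (hst : P ∈ Matrix.rowStochastic ℝ (Fin h)) (hsum : ∑ u, π u = 1) (hinv : π ᵥ* P = π)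
    (g : Fin h → ℝ) : ∃ X : Fin h → ℝ, ∀ u, X u - (P *ᵥ X) u = g u - π ⬝ᵥ g := by
  let Φ : (Fin h → ℝ) →ₗ[ℝ] (Fin h → ℝ) :=
    { toFun := fun X => X - P *ᵥ X + fun _ => π ⬝ᵥ X
      map_add' := fun X Y => by
        ext u; simp [Matrix.mulVec_add, dotProduct_add]; ring
      map_smul' := fun k X => by
        ext u; simp [Matrix.mulVec_smul, dotProduct_smul]; ring }
  have hΦ : ∀ X u, Φ X u = X u - (P *ᵥ X) u + π ⬝ᵥ X := fun _ _ => rfl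
  have hpair : ∀ X, π ⬝ᵥ Φ X = π ⬝ᵥ X := by
    intro X
    have h1 : π ⬝ᵥ (P *ᵥ X) = π ⬝ᵥ X := by rw [Matrix.dotProduct_mulVec, hinv]
    have h2 : π ⬝ᵥ (fun _ => π ⬝ᵥ X) = π ⬝ᵥ X := by
      rw [dotProduct, ← Finset.sum_mul, hsum, one_mul]
    show π ⬝ᵥ (X - P *ᵥ X + fun _ => π ⬝ᵥ X) = _
    rw [dotProduct_add, dotProduct_sub, h1, h2, sub_self, zero_add]
  have hinj : Function.Injective Φ := by
    rw [← LinearMap.ker_eq_bot, LinearMap.ker_eq_bot']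
    intro X hX
    have h0 : π ⬝ᵥ X = 0 := by rw [← hpair, hX, dotProduct_zero]
    have hh : P *ᵥ X = X := by
      ext u
      have := congrFun hX u
      rw [hΦ, h0, Pi.zero_apply] at this
      linarith
    ext u
    have hc : ∀ v, X v = X u := fun v => eq_of_mulVec_eq hP hst hh v u
    rw [dotProduct] at h0
    simp only [hc, ← Finset.sum_mul, hsum, one_mul] at h0
    exact h0
  obtain ⟨X, hX⟩ := LinearMap.injective_iff_surjective.1 hinj fun u => g u - π ⬝ᵥ g
  refine ⟨X, fun u => ?_⟩
  have h0 : π ⬝ᵥ X = 0 := by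
    rw [← hpair, hX, dotProduct]
    simp only [mul_sub, Finset.sum_sub_distrib, ← Finset.sum_mul, hsum, one_mul]
    exact sub_self _
  have := congrFun hX u
  rw [hΦ, h0, add_zero] at this
  exact this

/-- A bounded process, adapted to the chain and `D`, whose increments at time `t` are of order
`1 / t`. -/
structure IsSlow {β : Type*} [MeasurableSpace β] (m : ℕ → Ω → Fin h) (D : Ω → β) (T₀ : ℕ)
    (Q : ℕ → Ω → ℝ) : Prop where
  measurable : ∀ t, T₀ ≤ t → Measurable[pastSigma m D t] (Q t)
  bound : ∃ C, ∀ t, T₀ ≤ t → ∀ ω, |Q t ω| ≤ C ∧ |Q (t + 1) ω - Q t ω| ≤ C / ((t : ℝ) + 1)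

section Slow

variable {β : Type*} [MeasurableSpace β] {D : Ω → β} {T₀ : ℕ} {Q Q' : ℕ → Ω → ℝ}

theorem IsSlow.const (k : ℝ) : IsSlow m D T₀ fun _ _ => k :=
  ⟨fun _ _ => measurable_const, |k|, fun t _ _ => ⟨le_rfl, by
    rw [sub_self, abs_zero]; positivity⟩⟩

theorem IsSlow.add (hQ : IsSlow m D T₀ Q) (hQ' : IsSlow m D T₀ Q') :
    IsSlow m D T₀ fun t ω => Q t ω + Q' t ω := by
  obtain ⟨C, hC⟩ := hQ.bound
  obtain ⟨C', hC'⟩ := hQ'.bound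
  refine ⟨fun t ht => (hQ.measurable t ht).add (hQ'.measurable t ht), C + C', fun t ht ω => ⟨?_, ?_⟩⟩
  · exact (abs_add_le _ _).trans (add_le_add (hC t ht ω).1 (hC' t ht ω).1)
  · rw [add_div]
    refine le_trans (le_of_eq ?_)
      ((abs_add_le _ _).trans (add_le_add (hC t ht ω).2 (hC' t ht ω).2))
    congr 1; ring

theorem IsSlow.mul (hQ : IsSlow m D T₀ Q) (hQ' : IsSlow m D T₀ Q') :
    IsSlow m D T₀ fun t ω => Q t ω * Q' t ω := by
  obtain ⟨C, hC⟩ := hQ.bound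
  obtain ⟨C', hC'⟩ := hQ'.bound
  refine ⟨fun t ht => (hQ.measurable t ht).mul (hQ'.measurable t ht), 2 * (C * C'),
    fun t ht ω => ?_⟩
  obtain ⟨h1, h2⟩ := hC t ht ω
  obtain ⟨h1', h2'⟩ := hC' t ht ω
  have h3' := (hC' (t + 1) (ht.trans (Nat.le_succ t)) ω).1
  have hC0 : 0 ≤ C := (abs_nonneg _).trans h1
  have hC0' : 0 ≤ C' := (abs_nonneg _).trans h1'
  have ht1 : (0 : ℝ) < t + 1 := by positivity
  constructor
  · rw [abs_mul]
    have := mul_le_mul h1 h1' (abs_nonneg _) hC0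
    have := mul_nonneg hC0 hC0'
    linarith
  · have e : Q (t + 1) ω * Q' (t + 1) ω - Q t ω * Q' t ω =
        (Q (t + 1) ω - Q t ω) * Q' (t + 1) ω + Q t ω * (Q' (t + 1) ω - Q' t ω) := by ring
    have e2 : 2 * (C * C') / ((t : ℝ) + 1) = C / (t + 1) * C' + C * (C' / (t + 1)) := by ring
    rw [e, e2]
    refine (abs_add_le _ _).trans (add_le_add ?_ ?_)
    · rw [abs_mul]
      exact mul_le_mul h2 h3' (abs_nonneg _) (by positivity)
    · rw [abs_mul]
      exact mul_le_mul h1 h2' (abs_nonneg _) hC0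

theorem IsSlow.sub (hQ : IsSlow m D T₀ Q) (hQ' : IsSlow m D T₀ Q') :
    IsSlow m D T₀ fun t ω => Q t ω - Q' t ω := by
  simpa [sub_eq_add_neg] using hQ.add ((IsSlow.const (-1)).mul hQ')

theorem IsSlow.sum {ι : Type*} (s : Finset ι) {Q : ι → ℕ → Ω → ℝ}
    (hQ : ∀ i ∈ s, IsSlow m D T₀ (Q i)) : IsSlow m D T₀ fun t ω => ∑ i ∈ s, Q i t ω := by
  classical
  induction s using Finset.induction_on with
  | empty => simpa using IsSlow.const 0
  | insert i s hi ih =>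
    simp only [Finset.sum_insert hi]
    exact (hQ i (Finset.mem_insert_self i s)).add
      (ih fun j hj => hQ j (Finset.mem_insert_of_mem hj))

theorem IsSlow.memLp (hQ : IsSlow m D T₀ Q) (hm : ∀ t, Measurable (m t)) (hD : Measurable D)
    {t : ℕ} (ht : T₀ ≤ t) (p : ENNReal) : MemLp (Q t) p μ := by
  obtain ⟨C, hC⟩ := hQ.bound
  exact MemLp.of_bound ((hQ.measurable t ht).mono (pastSigma_le hm hD t) le_rfl).aestronglyMeasurable
    C (ae_of_all _ fun ω => (hC t ht ω).1)

theorem IsSlow.integrable (hQ : IsSlow m D T₀ Q) (hm : ∀ t, Measurable (m t)) (hD : Measurable D)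
    {t : ℕ} (ht : T₀ ≤ t) : Integrable (Q t) μ :=
  memLp_one_iff_integrable.1 (hQ.memLp hm hD ht 1)

theorem IsSlow.integrable_mul (hQ : IsSlow m D T₀ Q) (hm : ∀ t, Measurable (m t))
    (hD : Measurable D) {t : ℕ} (ht : T₀ ≤ t) (s : ℕ) (k : Fin h → ℝ) :
    Integrable (fun ω => Q t ω * k (m s ω)) μ := by
  refine (hQ.integrable hm hD ht).mul_bdd (c := ∑ u, |k u|)
    ((measurable_of_finite k).comp (hm s)).aestronglyMeasurable (ae_of_all _ fun ω => ?_)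
  exact Finset.single_le_sum (f := fun v => |k v|) (fun v _ => abs_nonneg _) (Finset.mem_univ _)

/-- Averaging along the chain: against a slow process, a function of the chain may be replaced by
its stationary mean. The Poisson equation turns the difference into a telescoping term. -/
theorem IsSlow.averages (hQ : IsSlow m D T₀ Q) (hm : IsMarkovChain μ P m) (hP : P.IsIrreducible)
    (hπ : ∀ u, Tendsto (fun t => μ.real {ω | m t ω = u}) atTop (𝓝 (π u)))
    (hD : Measurable D) (hDm : IndepFun D (fun ω t => m t ω) μ) (g : Fin h → ℝ) :
    Averages T₀ (fun t => ∫ ω, Q t ω * g (m t ω) ∂μ)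
      (fun t => (π ⬝ᵥ g) * ∫ ω, Q t ω ∂μ) := by
  obtain ⟨X, hX⟩ := exists_poisson_solution hP hm.stochastic (hm.sum_limit hπ)
    (hm.limit_vecMul hπ) g
  obtain ⟨C, hC⟩ := hQ.bound
  set K : ℝ := ∑ u, |X u| with hK
  have hXK : ∀ u, |X u| ≤ K := fun u =>
    Finset.single_le_sum (f := fun v => |X v|) (fun v _ => abs_nonneg _) (Finset.mem_univ u)
  have hint : ∀ t s, T₀ ≤ t → ∀ k : Fin h → ℝ, Integrable (fun ω => Q t ω * k (m s ω)) μ :=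
    fun t s ht k => hQ.integrable_mul hm.measurable hD ht s k
  refine ⟨fun t => if T₀ ≤ t then ∫ ω, Q t ω * X (m t ω) ∂μ else 0, |C| * K, fun t => ?_,
    fun t ht => ?_⟩
  · have hK0 : 0 ≤ K := Finset.sum_nonneg fun u _ => abs_nonneg _
    by_cases ht : T₀ ≤ t
    · simp only [if_pos ht]
      have := norm_integral_le_of_norm_le_const (μ := μ) (f := fun ω => Q t ω * X (m t ω))
        (C := |C| * K) (ae_of_all _ fun ω => by
          rw [Real.norm_eq_abs, abs_mul]
          exact mul_le_mul ((hC t ht ω).1.trans (le_abs_self C)) (hXK _) (abs_nonneg _)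
            (abs_nonneg _))
      simpa using this
    · simpa [ht] using mul_nonneg (abs_nonneg C) hK0
  · have ht' : T₀ ≤ t + 1 := ht.trans (Nat.le_succ t)
    simp only [if_pos ht, if_pos ht']
    have h1 : ∫ ω, Q t ω * X (m (t + 1) ω) ∂μ = ∫ ω, Q t ω * (P *ᵥ X) (m t ω) ∂μ :=
      hm.integral_mul hD hDm (hQ.measurable t ht) (fun ω => (hC t ht ω).1) X
    have h2 : ∫ ω, Q t ω * g (m t ω) ∂μ = (π ⬝ᵥ g) * (∫ ω, Q t ω ∂μ)
        + ((∫ ω, Q t ω * X (m t ω) ∂μ) - ∫ ω, Q t ω * (P *ᵥ X) (m t ω) ∂μ) := by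
      rw [← integral_sub (hint t t ht X) (hint t t ht _), ← integral_const_mul, ← integral_add]
      · refine integral_congr_ae (ae_of_all _ fun ω => ?_)
        have := hX (m t ω)
        show Q t ω * g (m t ω) = π ⬝ᵥ g * Q t ω
          + (Q t ω * X (m t ω) - Q t ω * (P *ᵥ X) (m t ω))
        rw [← mul_sub, this]; ring
      · simpa using (hint t t ht fun _ => 1).const_mul (π ⬝ᵥ g)
      · exact (hint t t ht X).sub (hint t t ht _)
    have h3 : (∫ ω, Q t ω * g (m t ω) ∂μ) - (π ⬝ᵥ g) * (∫ ω, Q t ω ∂μ)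
        - ((∫ ω, Q t ω * X (m t ω) ∂μ) - ∫ ω, Q (t + 1) ω * X (m (t + 1) ω) ∂μ) =
        ∫ ω, (Q (t + 1) ω * X (m (t + 1) ω) - Q t ω * X (m (t + 1) ω)) ∂μ := by
      rw [integral_sub (hint _ _ ht' X) (hint _ _ ht X), h1, h2]; ring
    rw [h3]
    have := norm_integral_le_of_norm_le_const (μ := μ)
      (f := fun ω => Q (t + 1) ω * X (m (t + 1) ω) - Q t ω * X (m (t + 1) ω))
      (C := |C| / (t + 1) * K) (ae_of_all _ fun ω => by
        rw [← sub_mul, Real.norm_eq_abs, abs_mul]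
        refine mul_le_mul ((hC t ht ω).2.trans ?_) (hXK _) (abs_nonneg _) (by positivity)
        exact div_le_div_of_nonneg_right (le_abs_self C) (by positivity))
    simp only [Real.norm_eq_abs, probReal_univ, mul_one] at this
    exact this.trans (le_of_eq (by ring))

end Slow

end MarkovChain

/-! ### The compressed closed loop -/

theorem abs_proj_sub_le {M ζ ξ : ℝ} (hξ : |ξ| ≤ M) : |proj M ζ - ξ| ≤ |ζ - ξ| := by
  have e1 : proj M ξ = ξ := by
    rw [proj, min_eq_left (abs_le.1 hξ).2, max_eq_right (abs_le.1 hξ).1]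
  calc |proj M ζ - ξ| = |proj M ζ - proj M ξ| := by rw [e1]
    _ ≤ |min ζ M - min ξ M| := by
      simpa [proj] using abs_max_sub_max_le_max (-M) (min ζ M) (-M) (min ξ M)
    _ ≤ |ζ - ξ| := by simpa using abs_min_sub_min_le_max ζ M ξ M

theorem mem_nbrs {N : ℕ} {H : SimpleGraph (Fin N)} {i j : Fin N} : j ∈ nbrs H i ↔ H.Adj i j := by
  classical
  simp [nbrs]

open Classical in
/-- The closed loop in terms of the compressed states `y` alone: they are first-order integrators
coupled through the estimates `z`, and the estimates only see the compressed states. -/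
structure ReducedLoop {Ω : Type*} {N h : ℕ} (G : Fin h → SimpleGraph (Fin N)) (σ : ℝ≥0)
    (c : Fin N → Fin N → ℝ) (M β γ : ℝ) (t₀ : ℕ) (m : ℕ → Ω → Fin h)
    (d : ℕ → Fin N → Fin N → Ω → ℝ) (y : ℕ → Fin N → Ω → ℝ) (z : ℕ → Fin N → Fin N → Ω → ℝ) :
    Prop where
  bound_nonneg : 0 ≤ M
  gain_pos : 0 < γ
  gain_lt : ∀ i, γ * ((nbrs (unionGraph G) i).card : ℝ) < (t₀ : ℝ) + 1
  init_y : ∀ i, ∃ y₀, |y₀| ≤ M ∧ ∀ ω, y (t₀ + 1) i ω = y₀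
  init_z : ∀ i j, (unionGraph G).Adj i j → ∃ z₀, |z₀| ≤ M ∧ ∀ ω, z t₀ i j ω = z₀
  estimate : ∀ t, t₀ ≤ t → ∀ i j, (unionGraph G).Adj i j → ∀ ω,
    z (t + 1) i j ω = proj M (z t i j ω + if (G (m (t + 1) ω)).Adj i j then
      β / ((t : ℝ) + 1) * (noiseF σ (c i j - z t i j ω) -
        oneBit (y (t + 1) j ω + d (t + 1) i j ω) (c i j)) else 0)
  update : ∀ t, t₀ + 1 ≤ t → ∀ i ω,
    y (t + 1) i ω = y t i ω + γ / ((t : ℝ) + 1) *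
      ∑ j ∈ nbrs (G (m t ω)) i, (z t i j ω - y t i ω)

theorem ClosedLoop.reducedLoop {Ω : Type*} {p N h : ℕ} (hN : 2 ≤ N) {a : Fin (p + 1) → ℝ}
    {b : Fin p → ℝ} {G : Fin h → SimpleGraph (Fin N)} {σ : ℝ≥0} {c : Fin N → Fin N → ℝ}
    {M β γ : ℝ} {t₀ : ℕ} {x₀ : Fin N → Fin (p + 1) → ℝ} {z₀ : Fin N → Fin N → ℝ}
    {m : ℕ → Ω → Fin h} {d : ℕ → Fin N → Fin N → Ω → ℝ} {x : ℕ → Fin N → Ω → Fin (p + 1) → ℝ}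
    {z : ℕ → Fin N → Fin N → Ω → ℝ} (hloop : ClosedLoop a b G σ c M β γ t₀ x₀ z₀ m d x z)
    (hγ : 0 < γ) (ht₀γ : ∀ i, γ * ((nbrs (unionGraph G) i).card : ℝ) - 1 < (t₀ : ℝ))
    (hx₀ : ∀ i, |compress b (x₀ i)| ≤ M)
    (hz₀ : ∀ i j, (unionGraph G).Adj i j → |z₀ i j| ≤ M) :
    ReducedLoop G σ c M β γ t₀ m d (fun t i ω => compress b (x t i ω)) z where
  bound_nonneg := (abs_nonneg _).trans (hx₀ ⟨0, by omega⟩)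
  gain_pos := hγ
  gain_lt i := by linarith [ht₀γ i]
  init_y i := ⟨_, hx₀ i, fun ω => by simp only [hloop.init_x]⟩
  init_z i j hij := ⟨_, hz₀ i j hij, fun ω => hloop.init_z i j hij ω⟩
  estimate t ht i j hij ω := by
    have := hloop.estimate (t + 1) (by omega) i j hij ω
    simpa using this
  update t ht i ω := by
    simp only [hloop.update t ht i ω]
    exact compress_update a b γ (G (m t ω)) t (fun k => x t k ω) (fun k l => z t k l ω) i

namespace ReducedLoop

section Pathwise

variable {Ω : Type*} {N h : ℕ} {G : Fin h → SimpleGraph (Fin N)} {σ : ℝ≥0}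
  {c : Fin N → Fin N → ℝ} {M β γ : ℝ} {t₀ : ℕ} {m : ℕ → Ω → Fin h}
  {d : ℕ → Fin N → Fin N → Ω → ℝ} {y : ℕ → Fin N → Ω → ℝ} {z : ℕ → Fin N → Fin N → Ω → ℝ}

theorem abs_z_le (H : ReducedLoop G σ c M β γ t₀ m d y z) {t : ℕ} (ht : t₀ ≤ t) {i j : Fin N}
    (hij : (unionGraph G).Adj i j) (ω : Ω) : |z t i j ω| ≤ M := by
  rcases Nat.eq_or_lt_of_le ht with rfl | ht'
  · obtain ⟨z₀, hz, he⟩ := H.init_z i j hij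
    rw [he]; exact hz
  · obtain ⟨s, rfl⟩ := Nat.exists_eq_succ_of_ne_zero (by omega : t ≠ 0)
    rw [Nat.succ_eq_add_one, H.estimate s (by omega) i j hij]
    exact (proj_isMin H.bound_nonneg _).1

/-- The gain condition at the initial time makes each update a convex combination. -/
theorem abs_y_le (H : ReducedLoop G σ c M β γ t₀ m d y z) {t : ℕ} (ht : t₀ + 1 ≤ t) (i : Fin N)
    (ω : Ω) : |y t i ω| ≤ M := by
  induction t, ht using Nat.le_induction generalizing i with
  | base =>
    obtain ⟨y₀, hy, he⟩ := H.init_y i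
    rw [he]; exact hy
  | succ t ht ih =>
    rw [H.update t ht]
    set s : ℝ := γ / ((t : ℝ) + 1) with hs
    set S : Finset (Fin N) := nbrs (G (m t ω)) i with hS
    have htp : (0 : ℝ) < t + 1 := by positivity
    have hs0 : 0 ≤ s := div_nonneg H.gain_pos.le htp.le
    have hsub : S ⊆ nbrs (unionGraph G) i := fun j hj =>
      mem_nbrs.2 (adj_unionGraph (mem_nbrs.1 hj))
    have hs1 : s * S.card ≤ 1 := by
      rw [hs, div_mul_eq_mul_div, div_le_one htp]
      have h1 : (S.card : ℝ) ≤ (nbrs (unionGraph G) i).card := by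
        exact_mod_cast Finset.card_le_card hsub
      have h2 := mul_le_mul_of_nonneg_left h1 H.gain_pos.le
      have h3 : (t₀ : ℝ) + 1 ≤ t := by exact_mod_cast ht
      linarith [H.gain_lt i]
    have e : y t i ω + s * ∑ j ∈ S, (z t i j ω - y t i ω) =
        (1 - s * S.card) * y t i ω + s * ∑ j ∈ S, z t i j ω := by
      rw [Finset.sum_sub_distrib, Finset.sum_const, nsmul_eq_mul]; ring
    rw [e]
    have h1 : |∑ j ∈ S, z t i j ω| ≤ S.card * M := by
      refine (Finset.abs_sum_le_sum_abs _ _).trans ?_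
      rw [← nsmul_eq_mul]
      exact Finset.sum_le_card_nsmul _ _ _ fun j hj =>
        H.abs_z_le (by omega) (mem_nbrs.1 (hsub hj)) ω
    calc |(1 - s * S.card) * y t i ω + s * ∑ j ∈ S, z t i j ω|
        ≤ |(1 - s * S.card) * y t i ω| + |s * ∑ j ∈ S, z t i j ω| := abs_add_le _ _
      _ = (1 - s * S.card) * |y t i ω| + s * |∑ j ∈ S, z t i j ω| := by
          rw [abs_mul, abs_mul, abs_of_nonneg (sub_nonneg.2 hs1), abs_of_nonneg hs0]
      _ ≤ (1 - s * S.card) * M + s * (S.card * M) :=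
          add_le_add (mul_le_mul_of_nonneg_left (ih i) (sub_nonneg.2 hs1))
            (mul_le_mul_of_nonneg_left h1 hs0)
      _ = M := by ring

theorem abs_sum_nbrs_le (H : ReducedLoop G σ c M β γ t₀ m d y z) {t : ℕ} (ht : t₀ + 1 ≤ t)
    (i : Fin N) (ω : Ω) : |∑ j ∈ nbrs (G (m t ω)) i, (z t i j ω - y t i ω)| ≤ N * (2 * M) := by
  have h1 : |∑ j ∈ nbrs (G (m t ω)) i, (z t i j ω - y t i ω)| ≤
      (nbrs (G (m t ω)) i).card * (2 * M) := by
    refine (Finset.abs_sum_le_sum_abs _ _).trans ?_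
    rw [← nsmul_eq_mul]
    refine Finset.sum_le_card_nsmul _ _ _ fun j hj => (abs_sub _ _).trans ?_
    linarith [H.abs_z_le (by omega : t₀ ≤ t) (adj_unionGraph (mem_nbrs.1 hj)) ω, H.abs_y_le ht i ω]
  refine h1.trans (mul_le_mul_of_nonneg_right ?_ (by linarith [H.bound_nonneg]))
  exact_mod_cast (Finset.card_le_univ _).trans (by simp)

theorem abs_y_succ_sub_le (H : ReducedLoop G σ c M β γ t₀ m d y z) {t : ℕ} (ht : t₀ + 1 ≤ t)
    (i : Fin N) (ω : Ω) : |y (t + 1) i ω - y t i ω| ≤ γ * (N * (2 * M)) / ((t : ℝ) + 1) := by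
  rw [H.update t ht, add_sub_cancel_left, abs_mul, abs_of_nonneg
    (div_nonneg H.gain_pos.le (by positivity)), div_mul_eq_mul_div]
  exact div_le_div_of_nonneg_right
    (mul_le_mul_of_nonneg_left (H.abs_sum_nbrs_le ht i ω) H.gain_pos.le) (by positivity)

open Classical in
theorem abs_correction_le (i j : Fin N) (t : ℕ) (ω : Ω) :
    |(if (G (m (t + 1) ω)).Adj i j then β / ((t : ℝ) + 1) * (noiseF σ (c i j - z t i j ω) -
      oneBit (y (t + 1) j ω + d (t + 1) i j ω) (c i j)) else 0)| ≤ |β| / ((t : ℝ) + 1) := by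
  have htp : (0 : ℝ) < t + 1 := by positivity
  split_ifs
  · have h1 := noiseF_mem_Icc σ (c i j - z t i j ω)
    have h2 := oneBit_mem_Icc (y (t + 1) j ω + d (t + 1) i j ω) (c i j)
    rw [abs_mul, abs_div, abs_of_pos htp]
    refine mul_le_of_le_one_right (by positivity) (abs_le.2 ⟨by linarith, by linarith⟩)
  · simpa using div_nonneg (abs_nonneg β) htp.le

theorem abs_z_succ_sub_le (H : ReducedLoop G σ c M β γ t₀ m d y z) {t : ℕ} (ht : t₀ ≤ t)
    {i j : Fin N} (hij : (unionGraph G).Adj i j) (ω : Ω) :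
    |z (t + 1) i j ω - z t i j ω| ≤ |β| / ((t : ℝ) + 1) := by
  rw [H.estimate t ht i j hij]
  refine (abs_proj_sub_le (H.abs_z_le ht hij ω)).trans ?_
  rw [add_sub_cancel_left]
  exact abs_correction_le i j t ω

/-- The coupling term in terms of the estimation errors. -/
theorem sum_nbrs_eq (u : Fin h) (y : Fin N → ℝ) (z : Fin N → Fin N → ℝ) (i : Fin N) :
    ∑ j ∈ nbrs (G u) i, (z i j - y i) =
      (matW G u *ᵥ (fun e : Edges G => z e.1.1 e.1.2 - y e.1.2) - laplacian (G u) *ᵥ y) i := by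
  rw [Pi.sub_apply, matW_mulVec_apply G u (fun i j => z i j - y j), laplacian_mulVec_apply,
    ← Finset.sum_sub_distrib]
  exact Finset.sum_congr rfl fun j _ => by ring

/-- Compressed states and estimates are determined by the chain and the noises up to the present:
they are measurable for any σ-algebra that makes these measurable. -/
theorem measurable_of_le [MeasurableSpace Ω] (H : ReducedLoop G σ c M β γ t₀ m d y z) {T : ℕ}
    (hm : ∀ s ≤ T, Measurable (m s)) (hd : ∀ s ≤ T, ∀ i j, Measurable (d s i j)) {t : ℕ}
    (ht : t₀ ≤ t) (htT : t ≤ T) :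
    (∀ i j, (unionGraph G).Adj i j → Measurable (z t i j)) ∧ ∀ i, Measurable (y (t + 1) i) := by
  classical
  have hadj : ∀ s ≤ T, ∀ i j, MeasurableSet {ω | (G (m s ω)).Adj i j} := fun s hs i j =>
    hm s hs (Set.toFinite {u | (G u).Adj i j}).measurableSet
  induction t, ht using Nat.le_induction with
  | base =>
    constructor
    · intro i j hij
      obtain ⟨z₀, -, he⟩ := H.init_z i j hij
      rw [show z t₀ i j = fun _ => z₀ from funext he]
      exact measurable_const
    · intro i
      obtain ⟨y₀, -, he⟩ := H.init_y i
      rw [show y (t₀ + 1) i = fun _ => y₀ from funext he]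
      exact measurable_const
  | succ t ht ih =>
    obtain ⟨ihz, ihy⟩ := ih (by omega)
    have hz : ∀ i j, (unionGraph G).Adj i j → Measurable (z (t + 1) i j) := by
      intro i j hij
      rw [show z (t + 1) i j = _ from funext fun ω => H.estimate t ht i j hij ω]
      have h1 : Measurable fun ω => noiseF σ (c i j - z t i j ω) -
          oneBit (y (t + 1) j ω + d (t + 1) i j ω) (c i j) :=
        ((noiseF_mono σ).measurable.comp (measurable_const.sub (ihz i j hij))).sub
          ((measurable_oneBit (c i j)).comp ((ihy j).add (hd (t + 1) htT i j)))
      have hp : Measurable (proj M) := measurable_const.max (measurable_id.min measurable_const)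
      exact hp.comp ((ihz i j hij).add (Measurable.ite (hadj (t + 1) htT i j)
        (h1.const_mul (β / ((t : ℝ) + 1))) measurable_const))
    refine ⟨hz, fun i => ?_⟩
    rw [show y (t + 1 + 1) i = _ from funext fun ω => H.update (t + 1) (by omega) i ω]
    refine (ihy i).add (Measurable.const_mul ?_ _)
    have e : ∀ ω, ∑ j ∈ nbrs (G (m (t + 1) ω)) i, (z (t + 1) i j ω - y (t + 1) i ω) =
        ∑ j, if (G (m (t + 1) ω)).Adj i j then z (t + 1) i j ω - y (t + 1) i ω else 0 := by
      intro ω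
      rw [nbrs, Finset.sum_filter]
    simp only [e]
    refine Finset.measurable_sum _ fun j _ => ?_
    by_cases hij : (unionGraph G).Adj i j
    · exact Measurable.ite (hadj (t + 1) htT i j) ((hz i j hij).sub (ihy i)) measurable_const
    · have : ∀ ω, ¬ (G (m (t + 1) ω)).Adj i j := fun ω hω => hij (adj_unionGraph hω)
      simp only [this, if_false]
      exact measurable_const

end Pathwise

section Mean

variable {Ω : Type*} {mΩ : MeasurableSpace Ω} {μ : Measure Ω} [IsProbabilityMeasure μ]
  {N h : ℕ} {G : Fin h → SimpleGraph (Fin N)} {σ : ℝ≥0}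
  {c : Fin N → Fin N → ℝ} {M β γ : ℝ} {t₀ : ℕ} {m : ℕ → Ω → Fin h}
  {d : ℕ → Fin N → Fin N → Ω → ℝ} {y : ℕ → Fin N → Ω → ℝ} {z : ℕ → Fin N → Fin N → Ω → ℝ}

/-- All noises, as one random element. -/
def noiseFamily (d : ℕ → Fin N → Fin N → Ω → ℝ) (ω : Ω) (k : ℕ × Fin N × Fin N) : ℝ :=
  d k.1 k.2.1 k.2.2 ω

theorem measurable_noiseFamily (hd : ∀ t i j, Measurable (d t i j)) :
    Measurable (noiseFamily d) :=
  measurable_pi_lambda _ fun k => hd k.1 k.2.1 k.2.2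

theorem measurable_pastSigma (H : ReducedLoop G σ c M β γ t₀ m d y z) {t : ℕ} {T : ℕ}
    (ht : t₀ ≤ t) (htT : t ≤ T) :
    (∀ i j, (unionGraph G).Adj i j → Measurable[pastSigma m (noiseFamily d) T] (z t i j)) ∧
      ∀ i, Measurable[pastSigma m (noiseFamily d) T] (y (t + 1) i) := by
  have hpair : Measurable[pastSigma m (noiseFamily d) T]
      (fun ω => ((fun s : Fin (T + 1) => m s ω), noiseFamily d ω)) :=
    comap_measurable _
  refine @measurable_of_le Ω N h G σ c M β γ t₀ m d y z (pastSigma m (noiseFamily d) T) H T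
    (fun s hs => ?_) (fun s _ i j => ?_) t ht htT
  · exact (measurable_pi_apply (⟨s, Nat.lt_succ_of_le hs⟩ : Fin (T + 1))).comp
      (measurable_fst.comp hpair)
  · exact (measurable_pi_apply ((s, i, j) : ℕ × Fin N × Fin N)).comp (measurable_snd.comp hpair)

theorem isSlow_y (H : ReducedLoop G σ c M β γ t₀ m d y z) (i : Fin N) :
    IsSlow m (noiseFamily d) (t₀ + 1) fun t ω => y t i ω := by
  refine ⟨fun t ht => ?_, max M (γ * (N * (2 * M))), fun t ht ω => ⟨?_, ?_⟩⟩
  · obtain ⟨s, rfl⟩ := Nat.exists_eq_succ_of_ne_zero (by omega : t ≠ 0)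
    exact (H.measurable_pastSigma (by omega : t₀ ≤ s) (Nat.le_succ s)).2 i
  · exact (H.abs_y_le ht i ω).trans (le_max_left _ _)
  · exact (H.abs_y_succ_sub_le ht i ω).trans
      (div_le_div_of_nonneg_right (le_max_right _ _) (by positivity))

theorem isSlow_z (H : ReducedLoop G σ c M β γ t₀ m d y z) {i j : Fin N}
    (hij : (unionGraph G).Adj i j) :
    IsSlow m (noiseFamily d) (t₀ + 1) fun t ω => z t i j ω := by
  refine ⟨fun t ht => (H.measurable_pastSigma (by omega) le_rfl).1 i j hij, max M |β|, fun t ht ω => ⟨?_, ?_⟩⟩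
  · exact (H.abs_z_le (by omega) hij ω).trans (le_max_left _ _)
  · exact (H.abs_z_succ_sub_le (by omega) hij ω).trans
      (div_le_div_of_nonneg_right (le_max_right _ _) (by positivity))

end Mean

end ReducedLoop

/-! ### Mean-square recursions for the disagreement and the estimation error -/

namespace ReducedLoop

/-- The squared distance `‖J y‖²` of the compressed states from their average. -/
noncomputable def disagreement {Ω : Type*} {N : ℕ} (y : ℕ → Fin N → Ω → ℝ) (t : ℕ) (ω : Ω) : ℝ :=
  (matJ N *ᵥ fun i => y t i ω) ⬝ᵥ (matJ N *ᵥ fun i => y t i ω)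

/-- The estimation errors `ẑᵢⱼ - yⱼ`, indexed by the ordered edges. -/
def estError {Ω : Type*} {N h : ℕ} (G : Fin h → SimpleGraph (Fin N)) (y : ℕ → Fin N → Ω → ℝ)
    (z : ℕ → Fin N → Fin N → Ω → ℝ) (t : ℕ) (ω : Ω) (e : Edges G) : ℝ :=
  z t e.1.1 e.1.2 ω - y t e.1.2 ω

open Classical in
/-- The indicator that the edge `e` is active in topology `u`. -/
noncomputable def active {N h : ℕ} (G : Fin h → SimpleGraph (Fin N)) (e : Edges G) (u : Fin h) : ℝ :=
  if (G u).Adj e.1.1 e.1.2 then 1 else 0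

theorem active_mem_Icc {N h : ℕ} {G : Fin h → SimpleGraph (Fin N)} (e : Edges G) (u : Fin h) :
    0 ≤ active G e u ∧ active G e u ≤ 1 := by
  unfold active; split_ifs <;> simp

theorem piMin_le_dotProduct_active {N h : ℕ} {G : Fin h → SimpleGraph (Fin N)} {π : Fin h → ℝ}
    (hπ : ∀ u, 0 < π u) (e : Edges G) : piMin π ≤ π ⬝ᵥ active G e := by
  obtain ⟨u, hu⟩ : ∃ u, (G u).Adj e.1.1 e.1.2 := by
    simpa [unionGraph, SimpleGraph.iSup_adj] using e.2
  have h1 : piMin π ≤ π u := ciInf_le (Set.finite_range π).bddBelow u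
  have h2 : π u * active G e u ≤ π ⬝ᵥ active G e :=
    Finset.single_le_sum (f := fun v => π v * active G e v)
      (fun v _ => mul_nonneg (hπ v).le (active_mem_Icc e v).1) (Finset.mem_univ u)
  rw [active, if_pos hu, mul_one] at h2
  exact h1.trans h2

section Pathwise

variable {Ω : Type*} {N h : ℕ} {G : Fin h → SimpleGraph (Fin N)} {σ : ℝ≥0}
  {c : Fin N → Fin N → ℝ} {M β γ : ℝ} {t₀ : ℕ} {m : ℕ → Ω → Fin h}
  {d : ℕ → Fin N → Fin N → Ω → ℝ} {y : ℕ → Fin N → Ω → ℝ} {z : ℕ → Fin N → Fin N → Ω → ℝ}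

theorem update_eq (H : ReducedLoop G σ c M β γ t₀ m d y z) {t : ℕ} (ht : t₀ + 1 ≤ t) (ω : Ω) :
    (fun i => y (t + 1) i ω) = (fun i => y t i ω) + (γ / ((t : ℝ) + 1)) •
      (matW G (m t ω) *ᵥ estError G y z t ω - laplacian (G (m t ω)) *ᵥ fun i => y t i ω) := by
  ext i
  rw [H.update t ht, sum_nbrs_eq (m t ω) (fun i => y t i ω) (fun i j => z t i j ω)]
  rfl

theorem matJ_dotProduct_self_le (w : Fin N → ℝ) :
    (matJ N *ᵥ w) ⬝ᵥ (matJ N *ᵥ w) ≤ w ⬝ᵥ w := by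
  rw [matJ_dotProduct_matJ]
  have e : (matJ N *ᵥ w) ⬝ᵥ w = w ⬝ᵥ w - 1 / (N : ℝ) * (∑ k, w k) ^ 2 := by
    simp only [dotProduct, matJ_mulVec_apply, sub_mul, Finset.sum_sub_distrib, ← Finset.mul_sum]
    ring
  rw [e]
  have : (0 : ℝ) ≤ 1 / (N : ℝ) * (∑ k, w k) ^ 2 := by positivity
  linarith

theorem disagreement_succ_le (H : ReducedLoop G σ c M β γ t₀ m d y z)
    {T : Matrix (Fin N) (Fin N) ℝ} (hT : T ∈ Matrix.orthogonalGroup (Fin N) ℝ) {lam2 : ℝ}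
    (hlam2 : 0 < lam2) {t : ℕ} (ht : t₀ + 1 ≤ t) (ω : Ω) :
    disagreement y (t + 1) ω ≤ disagreement y t ω + (γ * lamG G T / lam2 *
        (estError G y z t ω ⬝ᵥ estError G y z t ω)
      - (2 * γ * ((fun i => y t i ω) ⬝ᵥ (laplacian (G (m t ω)) *ᵥ fun i => y t i ω))
        - γ * lam2 * disagreement y t ω)) / ((t : ℝ) + 1)
      + γ ^ 2 * (N * (N * (2 * M)) ^ 2) / ((t : ℝ) + 1) ^ 2 := by
  have hup := H.update_eq ht ω
  have hwb : ∀ i, |(matW G (m t ω) *ᵥ estError G y z t ω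
      - laplacian (G (m t ω)) *ᵥ fun i => y t i ω) i| ≤ N * (2 * M) := by
    intro i
    have e := sum_nbrs_eq (G := G) (m t ω) (fun i => y t i ω) (fun i j => z t i j ω) i
    have := H.abs_sum_nbrs_le ht i ω
    rwa [e] at this
  unfold disagreement
  rw [hup]
  set Y : Fin N → ℝ := fun i => y t i ω
  set ε := estError G y z t ω
  set w := matW G (m t ω) *ᵥ ε - laplacian (G (m t ω)) *ᵥ Y with hw
  set s : ℝ := γ / ((t : ℝ) + 1) with hs
  have hs0 : 0 ≤ s := div_nonneg H.gain_pos.le (by positivity)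
  have h1 : (matJ N *ᵥ (Y + s • w)) ⬝ᵥ (matJ N *ᵥ (Y + s • w)) =
      (matJ N *ᵥ Y) ⬝ᵥ (matJ N *ᵥ Y) + s * (2 * ((matJ N *ᵥ Y) ⬝ᵥ (matW G (m t ω) *ᵥ ε))
        - 2 * (Y ⬝ᵥ (laplacian (G (m t ω)) *ᵥ Y))) + s ^ 2 * ((matJ N *ᵥ w) ⬝ᵥ (matJ N *ᵥ w)) := by
    have e1 : (matJ N *ᵥ Y) ⬝ᵥ (matJ N *ᵥ w) =
        (matJ N *ᵥ Y) ⬝ᵥ (matW G (m t ω) *ᵥ ε) - Y ⬝ᵥ (laplacian (G (m t ω)) *ᵥ Y) := by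
      rw [matJ_dotProduct_matJ, hw, dotProduct_sub, matJ_dotProduct_laplacian]
    simp only [Matrix.mulVec_add, Matrix.mulVec_smul, add_dotProduct, dotProduct_add,
      smul_dotProduct, dotProduct_smul, smul_eq_mul, dotProduct_comm (matJ N *ᵥ w) (matJ N *ᵥ Y), e1]
    ring
  have h2 := two_mul_matJ_dotProduct_matW_le (G := G) hT hlam2 (m t ω) Y ε
  have h3 : (matJ N *ᵥ w) ⬝ᵥ (matJ N *ᵥ w) ≤ N * (N * (2 * M)) ^ 2 := by
    refine (matJ_dotProduct_self_le w).trans ?_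
    have := Finset.sum_le_card_nsmul Finset.univ (fun i => w i * w i) ((N * (2 * M)) ^ 2)
      (fun i _ => by rw [← sq]; exact sq_le_sq' (abs_le.1 (hwb i)).1 (abs_le.1 (hwb i)).2)
    simpa [dotProduct] using this
  rw [h1]
  have h4 := mul_le_mul_of_nonneg_left h2 hs0
  have h5 := mul_le_mul_of_nonneg_left h3 (sq_nonneg s)
  have e2 : (γ * lamG G T / lam2 * (ε ⬝ᵥ ε) - (2 * γ * (Y ⬝ᵥ (laplacian (G (m t ω)) *ᵥ Y))
      - γ * lam2 * ((matJ N *ᵥ Y) ⬝ᵥ (matJ N *ᵥ Y)))) / ((t : ℝ) + 1) =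
      s * (lam2 * ((matJ N *ᵥ Y) ⬝ᵥ (matJ N *ᵥ Y)) + lamG G T / lam2 * (ε ⬝ᵥ ε))
        - s * (2 * (Y ⬝ᵥ (laplacian (G (m t ω)) *ᵥ Y))) := by
    rw [hs]; ring
  have e3 : γ ^ 2 * (N * (N * (2 * M)) ^ 2) / ((t : ℝ) + 1) ^ 2 =
      s ^ 2 * (N * (N * (2 * M)) ^ 2) := by
    rw [hs, div_pow, div_mul_eq_mul_div]
  rw [e2, e3]
  linarith

/-- The errors are moved by the drift of the compressed states. -/
theorem neg_two_mul_sum_estError_mul_drift_le (H : ReducedLoop G σ c M β γ t₀ m d y z)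
    {T : Matrix (Fin N) (Fin N) ℝ} (hT : T ∈ Matrix.orthogonalGroup (Fin N) ℝ) {lam2 : ℝ}
    (hlam2 : 0 < lam2) (hlG : 0 < lamG G T) {t : ℕ} (ht : t₀ + 1 ≤ t) (ω : Ω) :
    -2 * ∑ e : Edges G, estError G y z t ω e * (y (t + 1) e.1.2 ω - y t e.1.2 ω) ≤
      (γ * alpha G T lam2 * (estError G y z t ω ⬝ᵥ estError G y z t ω)
        + γ * lamG G T / lam2 * disagreement y t ω) / ((t : ℝ) + 1) := by
  have hs0 : 0 ≤ γ / ((t : ℝ) + 1) := div_nonneg H.gain_pos.le (by positivity)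
  have h1 := mul_le_mul_of_nonneg_left (neg_two_mul_dotProduct_matQ_le (G := G) hT hlam2 hlG (m t ω)
    (fun i => y t i ω) (estError G y z t ω)) hs0
  have e1 : ∀ e : Edges G, y (t + 1) e.1.2 ω - y t e.1.2 ω = γ / ((t : ℝ) + 1) *
      (matQ G *ᵥ (matW G (m t ω) *ᵥ estError G y z t ω
        - laplacian (G (m t ω)) *ᵥ fun i => y t i ω)) e := by
    intro e
    rw [matQ_mulVec_apply]
    have := congrFun (H.update_eq ht ω) e.1.2
    rw [this, Pi.add_apply, Pi.smul_apply, smul_eq_mul, add_sub_cancel_left]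
  have e2 : -2 * ∑ e : Edges G, estError G y z t ω e * (y (t + 1) e.1.2 ω - y t e.1.2 ω) =
      γ / ((t : ℝ) + 1) * (-2 * (estError G y z t ω ⬝ᵥ
        (matQ G *ᵥ (matW G (m t ω) *ᵥ estError G y z t ω
          - laplacian (G (m t ω)) *ᵥ fun i => y t i ω)))) := by
    simp only [e1, dotProduct, Finset.mul_sum]
    exact Finset.sum_congr rfl fun e _ => by ring
  rw [e2]
  refine h1.trans (le_of_eq ?_)
  unfold disagreement
  ring

theorem abs_estError_le (H : ReducedLoop G σ c M β γ t₀ m d y z) {t : ℕ} (ht : t₀ + 1 ≤ t)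
    (e : Edges G) (ω : Ω) : |estError G y z t ω e| ≤ 2 * M :=
  (abs_sub _ _).trans (by
    linarith [H.abs_z_le (by omega : t₀ ≤ t) e.2 ω, H.abs_y_le ht e.1.2 ω])

/-- One step of an estimation error: the projection does not increase it, and the products of the
increments are of order `1 / t²`. -/
theorem estError_succ_sq_le (H : ReducedLoop G σ c M β γ t₀ m d y z) {t : ℕ} (ht : t₀ + 1 ≤ t)
    (e : Edges G) (ω : Ω) :
    estError G y z (t + 1) ω e ^ 2 ≤ estError G y z t ω e ^ 2
      - 2 * (estError G y z t ω e * (y (t + 1) e.1.2 ω - y t e.1.2 ω))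
      + 2 * β / ((t : ℝ) + 1) * (estError G y z t ω e * active G e (m (t + 1) ω) *
          noiseF σ (c e.1.1 e.1.2 - z t e.1.1 e.1.2 ω)
        - estError G y z t ω e * active G e (m (t + 1) ω) *
          oneBit (y (t + 1) e.1.2 ω + d (t + 1) e.1.1 e.1.2 ω) (c e.1.1 e.1.2))
      + (|β| + γ * (N * (2 * M))) ^ 2 / ((t : ℝ) + 1) ^ 2 := by
  classical
  have htp : (0 : ℝ) < (t : ℝ) + 1 := by positivity
  have hδ := H.abs_y_succ_sub_le ht e.1.2 ω
  have hr := abs_correction_le (G := G) (σ := σ) (c := c) (β := β) (m := m) (d := d) (y := y) (z := z)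
    e.1.1 e.1.2 t ω
  have hproj : |estError G y z (t + 1) ω e| ≤ |z t e.1.1 e.1.2 ω +
      (if (G (m (t + 1) ω)).Adj e.1.1 e.1.2 then β / ((t : ℝ) + 1) *
        (noiseF σ (c e.1.1 e.1.2 - z t e.1.1 e.1.2 ω) -
        oneBit (y (t + 1) e.1.2 ω + d (t + 1) e.1.1 e.1.2 ω) (c e.1.1 e.1.2)) else 0)
      - y (t + 1) e.1.2 ω| := by
    rw [estError, H.estimate t (by omega) _ _ e.2]
    exact abs_proj_sub_le (H.abs_y_le (by omega) _ _)
  have hra : (if (G (m (t + 1) ω)).Adj e.1.1 e.1.2 then β / ((t : ℝ) + 1) *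
        (noiseF σ (c e.1.1 e.1.2 - z t e.1.1 e.1.2 ω) -
        oneBit (y (t + 1) e.1.2 ω + d (t + 1) e.1.1 e.1.2 ω) (c e.1.1 e.1.2)) else 0) =
      active G e (m (t + 1) ω) * (β / ((t : ℝ) + 1)) *
        (noiseF σ (c e.1.1 e.1.2 - z t e.1.1 e.1.2 ω) -
        oneBit (y (t + 1) e.1.2 ω + d (t + 1) e.1.1 e.1.2 ω) (c e.1.1 e.1.2)) := by
    unfold active; split_ifs <;> ring
  rw [hra] at hr hproj
  set r : ℝ := active G e (m (t + 1) ω) * (β / ((t : ℝ) + 1)) *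
        (noiseF σ (c e.1.1 e.1.2 - z t e.1.1 e.1.2 ω) -
        oneBit (y (t + 1) e.1.2 ω + d (t + 1) e.1.1 e.1.2 ω) (c e.1.1 e.1.2)) with hrdef
  set δ : ℝ := y (t + 1) e.1.2 ω - y t e.1.2 ω with hδdef
  set ε : ℝ := estError G y z t ω e with hε
  have e1 : z t e.1.1 e.1.2 ω + r - y (t + 1) e.1.2 ω = ε - δ + r := by
    rw [hε, hδdef, estError]; ring
  rw [e1] at hproj
  have h1 : estError G y z (t + 1) ω e ^ 2 ≤ (ε - δ + r) ^ 2 := sq_le_sq.2 hproj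
  have h2 : |r - δ| ≤ (|β| + γ * (N * (2 * M))) / ((t : ℝ) + 1) := by
    rw [add_div]
    exact (abs_sub _ _).trans (add_le_add hr hδ)
  have h3 : (r - δ) ^ 2 ≤ (|β| + γ * (N * (2 * M))) ^ 2 / ((t : ℝ) + 1) ^ 2 := by
    rw [← div_pow]
    exact sq_le_sq' (abs_le.1 h2).1 (abs_le.1 h2).2
  have e2 : 2 * β / ((t : ℝ) + 1) * (ε * active G e (m (t + 1) ω) *
          noiseF σ (c e.1.1 e.1.2 - z t e.1.1 e.1.2 ω)
        - ε * active G e (m (t + 1) ω) *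
          oneBit (y (t + 1) e.1.2 ω + d (t + 1) e.1.1 e.1.2 ω) (c e.1.1 e.1.2)) = 2 * ε * r := by
    rw [hrdef]; ring
  rw [e2]
  nlinarith

end Pathwise

section Mean

variable {Ω : Type*} {mΩ : MeasurableSpace Ω} {μ : Measure Ω} [IsProbabilityMeasure μ]
  {N h : ℕ} {G : Fin h → SimpleGraph (Fin N)} {σ : ℝ≥0}
  {c : Fin N → Fin N → ℝ} {M β γ : ℝ} {t₀ : ℕ} {m : ℕ → Ω → Fin h}
  {d : ℕ → Fin N → Fin N → Ω → ℝ} {y : ℕ → Fin N → Ω → ℝ} {z : ℕ → Fin N → Fin N → Ω → ℝ}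

theorem isSlow_estError (H : ReducedLoop G σ c M β γ t₀ m d y z) (e : Edges G) :
    IsSlow m (noiseFamily d) (t₀ + 1) fun t ω => estError G y z t ω e :=
  (H.isSlow_z e.2).sub (H.isSlow_y e.1.2)

theorem isSlow_estError_sq (H : ReducedLoop G σ c M β γ t₀ m d y z) (e : Edges G) :
    IsSlow m (noiseFamily d) (t₀ + 1) fun t ω => estError G y z t ω e ^ 2 := by
  simpa [sq] using (H.isSlow_estError e).mul (H.isSlow_estError e)

theorem isSlow_disagreement (H : ReducedLoop G σ c M β γ t₀ m d y z) :
    IsSlow m (noiseFamily d) (t₀ + 1) (disagreement y) := by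
  have h1 : ∀ i, IsSlow m (noiseFamily d) (t₀ + 1)
      fun t ω => (matJ N *ᵥ fun i => y t i ω) i := by
    intro i
    simp only [matJ_mulVec_apply]
    exact (H.isSlow_y i).sub ((IsSlow.const _).mul (IsSlow.sum _ fun k _ => H.isSlow_y k))
  exact IsSlow.sum Finset.univ fun i _ => (h1 i).mul (h1 i)

/-- The noise at time `t + 1` is independent of the chain and the earlier noises, so the one-bit
observation may be replaced by the noise distribution function. -/
theorem integral_mul_oneBit_noise (H : ReducedLoop G σ c M β γ t₀ m d y z)
    (hd : IsGaussianNoise μ σ d) (hm : ∀ t, Measurable (m t))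
    (hdm : IndepFun (noiseFamily d) (fun ω (t : ℕ) => m t ω) μ) {t : ℕ} (ht : t₀ + 1 ≤ t)
    (e : Edges G) :
    ∫ ω, estError G y z t ω e * active G e (m (t + 1) ω) *
        oneBit (y (t + 1) e.1.2 ω + d (t + 1) e.1.1 e.1.2 ω) (c e.1.1 e.1.2) ∂μ =
      ∫ ω, estError G y z t ω e * active G e (m (t + 1) ω) *
        noiseF σ (c e.1.1 e.1.2 - y (t + 1) e.1.2 ω) ∂μ := by
  classical
  let S : Finset (ℕ × Fin N × Fin N) := Finset.range (t + 1) ×ˢ Finset.univ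
  let k₀ : ℕ × Fin N × Fin N := (t + 1, e.1.1, e.1.2)
  let X : Ω → ℕ → Fin h := fun ω s => m s ω
  let U : Ω → S → ℝ := fun ω k => noiseFamily d ω k
  let W : Ω → ℝ := d (t + 1) e.1.1 e.1.2
  have hX : Measurable X := measurable_pi_lambda _ hm
  have hU : Measurable U := measurable_pi_lambda _ fun k => hd.measurable _ _ _
  have hW : Measurable W := hd.measurable _ _ _
  have hUW : IndepFun U W μ := by
    have hdisj : Disjoint S {k₀} := by
      simp [S, k₀]
    have h1 := hd.indep.indepFun_finset S {k₀} hdisj fun k => hd.measurable _ _ _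
    exact h1.comp measurable_id
      (measurable_pi_apply (⟨k₀, Finset.mem_singleton_self k₀⟩ : ({k₀} : Finset _)))
  have hXUW : IndepFun X (fun ω => (U ω, W ω)) μ := by
    have hf : Measurable fun v : ℕ × Fin N × Fin N → ℝ => ((fun k : S => v k), v k₀) :=
      (measurable_pi_lambda _ fun k : S => measurable_pi_apply (k : ℕ × Fin N × Fin N)).prodMk
        (measurable_pi_apply k₀)
    exact hdm.symm.comp measurable_id hf
  have hind : IndepFun (fun ω => (X ω, U ω)) W μ := indepFun_prodMk_of_indepFun hX hU hW hXUW hUW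
  have hpair : Measurable[MeasurableSpace.comap (fun ω => (X ω, U ω)) inferInstance]
      fun ω => (X ω, U ω) := comap_measurable _
  have hmG : ∀ s, Measurable[MeasurableSpace.comap (fun ω => (X ω, U ω)) inferInstance] (m s) :=
    fun s => (measurable_pi_apply s).comp (measurable_fst.comp hpair)
  have hmeas : ∀ {s}, t₀ ≤ s → s ≤ t → _ := fun {s} hs hst =>
    @measurable_of_le Ω N h G σ c M β γ t₀ m d y z
      (MeasurableSpace.comap (fun ω => (X ω, U ω)) inferInstance) H t (fun s _ => hmG s)
      (fun s hs i j => by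
        have hk : (s, i, j) ∈ S := by simp [S]; omega
        exact (measurable_pi_apply (⟨(s, i, j), hk⟩ : S)).comp (measurable_snd.comp hpair))
      s hs hst
  have hφ : Measurable[MeasurableSpace.comap (fun ω => (X ω, U ω)) inferInstance]
      fun ω => estError G y z t ω e * active G e (m (t + 1) ω) := by
    obtain ⟨s, rfl⟩ := Nat.exists_eq_succ_of_ne_zero (by omega : t ≠ 0)
    exact (((hmeas (by omega) le_rfl).1 _ _ e.2).sub
      ((hmeas (by omega : t₀ ≤ s) (Nat.le_succ s)).2 _)).mul
        ((measurable_of_finite (active G e)).comp (hmG _))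
  have hY : Measurable[MeasurableSpace.comap (fun ω => (X ω, U ω)) inferInstance]
      (y (t + 1) e.1.2) := (hmeas (by omega) le_rfl).2 _
  have hle : MeasurableSpace.comap (fun ω => (X ω, U ω)) inferInstance ≤ mΩ :=
    (hX.prodMk hU).comap_le
  refine integral_mul_oneBit (hφ.mono hle le_rfl) (hY.mono hle le_rfl) hW (hd.law _ _ _) ?_
    (C := 2 * M) (fun ω => ?_) _
  · exact indep_of_indep_of_le_left hind (Measurable.comap_le (hφ.prodMk hY))
  · have h1 := active_mem_Icc e (m (t + 1) ω)
    rw [abs_mul, abs_of_nonneg h1.1]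
    exact (mul_le_of_le_one_right (abs_nonneg _) h1.2).trans (H.abs_estError_le ht e ω)

theorem integral_estError_succ_sq_le (H : ReducedLoop G σ c M β γ t₀ m d y z) (hσ : 0 < σ)
    (hβ : 0 ≤ β) (hd : IsGaussianNoise μ σ d) (hm : ∀ t, Measurable (m t))
    (hdm : IndepFun (noiseFamily d) (fun ω (t : ℕ) => m t ω) μ) {t : ℕ} (ht : t₀ + 1 ≤ t)
    (e : Edges G) :
    ∫ ω, estError G y z (t + 1) ω e ^ 2 ∂μ ≤ (∫ ω, estError G y z t ω e ^ 2 ∂μ)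
      - 2 * (∫ ω, estError G y z t ω e * (y (t + 1) e.1.2 ω - y t e.1.2 ω) ∂μ)
      - 2 * β * fMin σ c M / ((t : ℝ) + 1) *
        (∫ ω, estError G y z t ω e ^ 2 * active G e (m (t + 1) ω) ∂μ)
      + (4 * β * (M * (noiseDensity σ 0 * (γ * (N * (2 * M))))) + (|β| + γ * (N * (2 * M))) ^ 2)
        / ((t : ℝ) + 1) ^ 2 := by
  have hD : Measurable (noiseFamily d) := measurable_noiseFamily hd.measurable
  have htp : (0 : ℝ) < (t : ℝ) + 1 := by positivity
  have ht' : t₀ + 1 ≤ t + 1 := by omega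
  have hFm : Measurable (noiseF σ) := (noiseF_mono σ).measurable
  have hmz : Measurable (z t e.1.1 e.1.2) :=
    (H.measurable_of_le (T := t) (fun s _ => hm s) (fun s _ => hd.measurable s) (by omega)
      le_rfl).1 _ _ e.2
  have hmy : Measurable (y (t + 1) e.1.2) :=
    (H.measurable_of_le (T := t) (fun s _ => hm s) (fun s _ => hd.measurable s) (by omega)
      le_rfl).2 _
  set A : Ω → ℝ := fun ω => active G e (m (t + 1) ω) with hA
  set ε : Ω → ℝ := fun ω => estError G y z t ω e with hε
  set δ : Ω → ℝ := fun ω => y (t + 1) e.1.2 ω - y t e.1.2 ω with hδ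
  set c' : ℝ := c e.1.1 e.1.2 with hc'
  set κ : ℝ := M * (noiseDensity σ 0 * (γ * (N * (2 * M)))) with hκ
  have iε : Integrable ε μ := (H.isSlow_estError e).integrable hm hD ht
  have iε2 : Integrable (fun ω => ε ω ^ 2) μ := (H.isSlow_estError_sq e).integrable hm hD ht
  have iεA : Integrable (fun ω => ε ω * A ω) μ := (H.isSlow_estError e).integrable_mul hm hD ht (t + 1) (active G e)
  have iε2A : Integrable (fun ω => ε ω ^ 2 * A ω) μ :=
    (H.isSlow_estError_sq e).integrable_mul hm hD ht (t + 1) (active G e)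
  have iF : ∀ {f : Ω → ℝ}, Measurable f → (∀ ω, 0 ≤ f ω ∧ f ω ≤ 1) →
      Integrable (fun ω => ε ω * A ω * f ω) μ := fun hf hb =>
    iεA.mul_bdd (c := 1) hf.aestronglyMeasurable (ae_of_all _ fun ω => by
      rw [Real.norm_eq_abs, abs_of_nonneg (hb ω).1]; exact (hb ω).2)
  have i1 : Integrable (fun ω => ε ω * A ω * noiseF σ (c' - z t e.1.1 e.1.2 ω)) μ :=
    iF (hFm.comp (measurable_const.sub hmz)) fun ω => noiseF_mem_Icc σ _
  have i2 : Integrable (fun ω => ε ω * A ω *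
      oneBit (y (t + 1) e.1.2 ω + d (t + 1) e.1.1 e.1.2 ω) c') μ :=
    iF ((measurable_oneBit c').comp (hmy.add (hd.measurable (t + 1) e.1.1 e.1.2)))
      fun ω => oneBit_mem_Icc _ _
  have i3 : Integrable (fun ω => ε ω * A ω * noiseF σ (c' - y (t + 1) e.1.2 ω)) μ :=
    iF (hFm.comp (measurable_const.sub hmy)) fun ω => noiseF_mem_Icc σ _
  have iδ : Integrable (fun ω => ε ω * δ ω) μ := by
    have h1 : Integrable (fun ω => y t e.1.2 ω) μ := (H.isSlow_y e.1.2).integrable hm hD ht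
    have h2 : Integrable (fun ω => y (t + 1) e.1.2 ω) μ := (H.isSlow_y e.1.2).integrable hm hD ht'
    refine (h2.sub h1).bdd_mul (c := 2 * M) iε.aestronglyMeasurable (ae_of_all _ fun ω => ?_)
    exact H.abs_estError_le ht e ω
  -- the mean correction pulls the error towards zero
  have hcorr : (∫ ω, ε ω * A ω * noiseF σ (c' - z t e.1.1 e.1.2 ω) ∂μ)
      - (∫ ω, ε ω * A ω * oneBit (y (t + 1) e.1.2 ω + d (t + 1) e.1.1 e.1.2 ω) c' ∂μ) ≤
      -fMin σ c M * (∫ ω, ε ω ^ 2 * A ω ∂μ) + 2 * κ / ((t : ℝ) + 1) := by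
    have hb : ∀ ω, ε ω * A ω * noiseF σ (c' - z t e.1.1 e.1.2 ω)
        - ε ω * A ω * noiseF σ (c' - y (t + 1) e.1.2 ω) ≤
        -fMin σ c M * (ε ω ^ 2 * A ω) + 2 * κ / ((t : ℝ) + 1) := by
      intro ω
      have hA01 := active_mem_Icc e (m (t + 1) ω)
      have h1 := mul_le_mul_of_nonneg_left (mul_noiseF_sub_le hσ c e.1.1 e.1.2
        (H.abs_y_le ht e.1.2 ω) (H.abs_z_le (by omega : t₀ ≤ t) e.2 ω)) hA01.1
      have h2 : A ω * ε ω * (noiseF σ (c' - y t e.1.2 ω) - noiseF σ (c' - y (t + 1) e.1.2 ω)) ≤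
          2 * κ / ((t : ℝ) + 1) := by
        refine (le_abs_self _).trans ?_
        rw [abs_mul, abs_mul, abs_of_nonneg hA01.1]
        have h3 := abs_noiseF_sub_le hσ (c' - y (t + 1) e.1.2 ω) (c' - y t e.1.2 ω)
        rw [sub_sub_sub_cancel_left] at h3
        have h4 := mul_le_mul_of_nonneg_left (H.abs_y_succ_sub_le ht e.1.2 ω)
          (gaussianPDFReal_nonneg 0 (σ ^ 2) 0)
        have h5 : A ω * |ε ω| ≤ 2 * M :=
          (mul_le_of_le_one_left (abs_nonneg _) hA01.2).trans (H.abs_estError_le ht e ω)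
        have h6 := mul_le_mul h5 (h3.trans h4) (abs_nonneg _) (by linarith [H.bound_nonneg])
        refine h6.trans (le_of_eq ?_)
        rw [hκ, noiseDensity]; ring
      have e1 : ε ω = z t e.1.1 e.1.2 ω - y t e.1.2 ω := rfl
      rw [← e1] at h1
      linarith
    have h8 := H.integral_mul_oneBit_noise hd hm hdm ht e
    have h9 := integral_sub i1 i3
    refine (le_of_eq ((congrArg _ h8).trans h9.symm)).trans ?_
    refine (integral_mono (i1.sub i3) ((iε2A.const_mul _).add (integrable_const _)) hb).trans ?_
    rw [integral_add' (iε2A.const_mul _) (integrable_const _), integral_const_mul, integral_const,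
      probReal_univ, one_smul]
  have j1 : Integrable (fun ω => ε ω ^ 2 - 2 * (ε ω * δ ω)) μ := iε2.sub (iδ.const_mul 2)
  have j2 : Integrable (fun ω => 2 * β / ((t : ℝ) + 1) *
      (ε ω * A ω * noiseF σ (c' - z t e.1.1 e.1.2 ω)
        - ε ω * A ω * oneBit (y (t + 1) e.1.2 ω + d (t + 1) e.1.1 e.1.2 ω) c')) μ :=
    (i1.sub i2).const_mul _
  have j3 : Integrable (fun ω => ε ω ^ 2 - 2 * (ε ω * δ ω) + 2 * β / ((t : ℝ) + 1) *
      (ε ω * A ω * noiseF σ (c' - z t e.1.1 e.1.2 ω)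
        - ε ω * A ω * oneBit (y (t + 1) e.1.2 ω + d (t + 1) e.1.1 e.1.2 ω) c')) μ := j1.add j2
  refine (integral_mono ((H.isSlow_estError_sq e).integrable (μ := μ) hm hD ht')
    (j3.add (integrable_const _)) (fun ω => H.estError_succ_sq_le ht e ω)).trans ?_
  rw [integral_add' j3 (integrable_const _), integral_add j1 j2, integral_sub iε2 (iδ.const_mul 2),
    integral_const_mul, integral_const_mul, integral_sub i1 i2, integral_const, probReal_univ,
    one_smul]
  have h7 := mul_le_mul_of_nonneg_left hcorr (by positivity : 0 ≤ 2 * β / ((t : ℝ) + 1))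
  have e2 : 2 * β / ((t : ℝ) + 1) * (-fMin σ c M * (∫ ω, ε ω ^ 2 * A ω ∂μ)
      + 2 * κ / ((t : ℝ) + 1)) = -(2 * β * fMin σ c M / ((t : ℝ) + 1) * (∫ ω, ε ω ^ 2 * A ω ∂μ))
      + 4 * β * κ / ((t : ℝ) + 1) ^ 2 := by
    field_simp; ring
  rw [e2] at h7
  rw [add_div]
  linarith

end Mean

end ReducedLoop

/-! ### Mean-square consensus -/

namespace ReducedLoop

variable {Ω : Type*} {mΩ : MeasurableSpace Ω} {μ : Measure Ω} [IsProbabilityMeasure μ]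
  {N h : ℕ} {G : Fin h → SimpleGraph (Fin N)} {σ : ℝ≥0}
  {c : Fin N → Fin N → ℝ} {M β γ : ℝ} {t₀ : ℕ} {m : ℕ → Ω → Fin h}
  {d : ℕ → Fin N → Fin N → Ω → ℝ} {y : ℕ → Fin N → Ω → ℝ} {z : ℕ → Fin N → Fin N → Ω → ℝ}
  {P : Matrix (Fin h) (Fin h) ℝ} {π : Fin h → ℝ}

theorem integral_estError_dotProduct (H : ReducedLoop G σ c M β γ t₀ m d y z)
    (hm : ∀ t, Measurable (m t)) (hD : Measurable (noiseFamily d)) {t : ℕ} (ht : t₀ + 1 ≤ t) :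
    ∫ ω, estError G y z t ω ⬝ᵥ estError G y z t ω ∂μ =
      ∑ e, ∫ ω, estError G y z t ω e ^ 2 ∂μ := by
  rw [← integral_finsetSum _ fun e _ => (H.isSlow_estError_sq e).integrable hm hD ht]
  simp only [dotProduct, sq]

theorem isSlow_estError_dotProduct (H : ReducedLoop G σ c M β γ t₀ m d y z) :
    IsSlow m (noiseFamily d) (t₀ + 1) fun t ω => estError G y z t ω ⬝ᵥ estError G y z t ω :=
  IsSlow.sum Finset.univ fun e _ => (H.isSlow_estError e).mul (H.isSlow_estError e)

/-- The coupling of the agents through the current Laplacian averages to the coupling through the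
mean Laplacian. -/
theorem averages_laplacian (H : ReducedLoop G σ c M β γ t₀ m d y z) (hm : IsMarkovChain μ P m)
    (hP : P.IsIrreducible)
    (hπ : ∀ u, Tendsto (fun t => μ.real {ω | m t ω = u}) atTop (𝓝 (π u)))
    (hD : Measurable (noiseFamily d))
    (hdm : IndepFun (noiseFamily d) (fun ω (t : ℕ) => m t ω) μ) :
    Averages (t₀ + 1)
      (fun t => ∑ i, ∑ j, ∫ ω, (y t i ω * y t j ω) * laplacian (G (m t ω)) i j ∂μ)
      (fun t => ∑ i, ∑ j, meanLaplacian G π i j * ∫ ω, y t i ω * y t j ω ∂μ) := by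
  refine Averages.sum _ fun i => Averages.sum _ fun j => ?_
  have h1 := ((H.isSlow_y i).mul (H.isSlow_y j)).averages hm hP hπ hD hdm
    (fun u => laplacian (G u) i j)
  have e : (π ⬝ᵥ fun u => laplacian (G u) i j) = meanLaplacian G π i j := by
    simp [meanLaplacian, dotProduct, Matrix.sum_apply]
  rwa [e] at h1

theorem dotProduct_mulVec_eq_sum (A : Matrix (Fin N) (Fin N) ℝ) (v : Fin N → ℝ) :
    v ⬝ᵥ (A *ᵥ v) = ∑ i, ∑ j, (v i * v j) * A i j := by
  simp only [dotProduct, Matrix.mulVec, Finset.mul_sum]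
  exact Finset.sum_congr rfl fun i _ => Finset.sum_congr rfl fun j _ => by ring

/-- The weight of an edge at the next time averages to its stationary weight. -/
theorem averages_active (H : ReducedLoop G σ c M β γ t₀ m d y z) (hm : IsMarkovChain μ P m)
    (hP : P.IsIrreducible)
    (hπ : ∀ u, Tendsto (fun t => μ.real {ω | m t ω = u}) atTop (𝓝 (π u)))
    (hD : Measurable (noiseFamily d))
    (hdm : IndepFun (noiseFamily d) (fun ω (t : ℕ) => m t ω) μ) (e : Edges G) :
    Averages (t₀ + 1) (fun t => ∫ ω, estError G y z t ω e ^ 2 * active G e (m (t + 1) ω) ∂μ)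
      (fun t => (π ⬝ᵥ active G e) * ∫ ω, estError G y z t ω e ^ 2 ∂μ) := by
  have h1 := (H.isSlow_estError_sq e).averages hm hP hπ hD hdm (P *ᵥ active G e)
  rw [Matrix.dotProduct_mulVec, hm.limit_vecMul hπ] at h1
  obtain ⟨ξ, C, hξ, hb⟩ := h1
  refine ⟨ξ, C, hξ, fun t ht => ?_⟩
  obtain ⟨K, hK⟩ := (H.isSlow_estError_sq e).bound
  have h2 := hm.integral_mul hD hdm ((H.isSlow_estError_sq e).measurable t ht)
    (fun ω => (hK t ht ω).1) (active G e)
  beta_reduce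
  rw [h2]
  exact hb t ht

/-- Both mean-square errors decay at every rate below the one allowed by the coupled recursions. -/
theorem exists_decay (H : ReducedLoop G σ c M β γ t₀ m d y z) (hN : 2 ≤ N)
    (hG : (unionGraph G).Connected) (hσ : 0 < σ) (hd : IsGaussianNoise μ σ d)
    (hP : P.IsIrreducible) (hm : IsMarkovChain μ P m)
    (hπ : ∀ u, Tendsto (fun t => μ.real {ω | m t ω = u}) atTop (𝓝 (π u)))
    (hdm : IndepFun (noiseFamily d) (fun ω (t : ℕ) => m t ω) μ)
    {T : Matrix (Fin N) (Fin N) ℝ} (hT : T ∈ Matrix.orthogonalGroup (Fin N) ℝ)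
    {lam : Fin N → ℝ} (hlam : Monotone lam)
    (hdiag : T⁻¹ * meanLaplacian G π * T = Matrix.diagonal lam) {lam2 : ℝ}
    (hlam2 : lam2 = lam ⟨1, hN⟩) (hβ : 0 ≤ β) {κ₀ : ℝ} (hκ₀ : κ₀ < γ * lam2)
    (hdet : (γ * lamG G T / lam2) ^ 2 <
      (γ * lam2 - κ₀) * (2 * β * fMin σ c M * piMin π - γ * alpha G T lam2 - κ₀)) :
    ∃ κ, κ₀ < κ ∧ ∀ ρ, 0 < ρ → ρ ≤ 1 → ρ < κ → ∃ K : ℝ, ∀ᶠ t : ℕ in atTop,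
      ∫ ω, disagreement y t ω ∂μ ≤ K * (t : ℝ) ^ (-ρ) ∧
      ∫ ω, estError G y z t ω ⬝ᵥ estError G y z t ω ∂μ ≤ K * (t : ℝ) ^ (-ρ) := by
  have hπ0 := hm.limit_pos hP hπ
  obtain ⟨hl0, hlq⟩ := lam_pos_and_le_dotProduct hN hG hπ0 hT hlam hdiag
  rw [← hlam2] at hl0 hlq
  have hlG := lamG_pos hN hG hT
  have hf := fMin_pos (by omega : 0 < N) hσ c M
  have hD : Measurable (noiseFamily d) := measurable_noiseFamily hd.measurable
  have hmm := hm.measurable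
  set V : ℕ → ℝ := fun t => ∫ ω, disagreement y t ω ∂μ with hV
  set R : ℕ → ℝ := fun t => ∫ ω, estError G y z t ω ⬝ᵥ estError G y z t ω ∂μ with hR
  set L : ℕ → ℝ := fun t =>
    ∑ i, ∑ j, ∫ ω, (y t i ω * y t j ω) * laplacian (G (m t ω)) i j ∂μ with hL
  set Lbar : ℕ → ℝ := fun t =>
    ∑ i, ∑ j, meanLaplacian G π i j * ∫ ω, y t i ω * y t j ω ∂μ with hLbar
  set r : ℕ → ℝ := fun t =>
    ∑ e : Edges G, ∫ ω, estError G y z t ω e ^ 2 * active G e (m (t + 1) ω) ∂μ with hr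
  set rbar : ℕ → ℝ := fun t =>
    ∑ e : Edges G, (π ⬝ᵥ active G e) * ∫ ω, estError G y z t ω e ^ 2 ∂μ with hrbar
  have hyy : ∀ t, t₀ + 1 ≤ t → ∀ i j, Integrable (fun ω => y t i ω * y t j ω) μ := fun t ht i j =>
    ((H.isSlow_y i).mul (H.isSlow_y j)).integrable hmm hD ht
  have hyyL : ∀ t, t₀ + 1 ≤ t → ∀ i j,
      Integrable (fun ω => (y t i ω * y t j ω) * laplacian (G (m t ω)) i j) μ := fun t ht i j =>
    ((H.isSlow_y i).mul (H.isSlow_y j)).integrable_mul hmm hD ht t fun u => laplacian (G u) i j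
  have iV : ∀ t, t₀ + 1 ≤ t → Integrable (disagreement y t) μ := fun t ht =>
    H.isSlow_disagreement.integrable hmm hD ht
  have iR : ∀ t, t₀ + 1 ≤ t →
      Integrable (fun ω => estError G y z t ω ⬝ᵥ estError G y z t ω) μ := fun t ht =>
    H.isSlow_estError_dotProduct.integrable hmm hD ht
  have hLint : ∀ t, t₀ + 1 ≤ t → Integrable (fun ω =>
      (fun i => y t i ω) ⬝ᵥ (laplacian (G (m t ω)) *ᵥ fun i => y t i ω)) μ ∧
      ∫ ω, (fun i => y t i ω) ⬝ᵥ (laplacian (G (m t ω)) *ᵥ fun i => y t i ω) ∂μ = L t := by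
    intro t ht
    simp only [dotProduct_mulVec_eq_sum]
    refine ⟨integrable_finsetSum _ fun i _ => integrable_finsetSum _ fun j _ => hyyL t ht i j, ?_⟩
    rw [integral_finsetSum _ fun i _ => integrable_finsetSum _ fun j _ => hyyL t ht i j]
    exact Finset.sum_congr rfl fun i _ => integral_finsetSum _ fun j _ => hyyL t ht i j
  have hLbarint : ∀ t, t₀ + 1 ≤ t → lam2 * V t ≤ Lbar t := by
    intro t ht
    have i1 : ∀ i j, Integrable (fun ω => (y t i ω * y t j ω) * meanLaplacian G π i j) μ :=
      fun i j => (hyy t ht i j).mul_const _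
    have e : Lbar t = ∫ ω, (fun i => y t i ω) ⬝ᵥ
        (meanLaplacian G π *ᵥ fun i => y t i ω) ∂μ := by
      simp only [dotProduct_mulVec_eq_sum]
      rw [integral_finsetSum _ fun i _ => integrable_finsetSum _ fun j _ => i1 i j]
      refine Finset.sum_congr rfl fun i _ => ?_
      rw [integral_finsetSum _ fun j _ => i1 i j]
      exact Finset.sum_congr rfl fun j _ => by rw [integral_mul_const, mul_comm]
    rw [e, hV, ← integral_const_mul]
    refine integral_mono ((iV t ht).const_mul _) ?_ fun ω => hlq fun i => y t i ω
    simp only [dotProduct_mulVec_eq_sum]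
    exact integrable_finsetSum _ fun i _ => integrable_finsetSum _ fun j _ => i1 i j
  have hrbarle : ∀ t, t₀ + 1 ≤ t → piMin π * R t ≤ rbar t := by
    intro t ht
    simp only [hR]
    rw [H.integral_estError_dotProduct hmm hD ht, Finset.mul_sum]
    exact Finset.sum_le_sum fun e _ => mul_le_mul_of_nonneg_right (piMin_le_dotProduct_active hπ0 e)
      (integral_nonneg fun ω => sq_nonneg _)
  set C₁ : ℝ := γ ^ 2 * (N * (N * (2 * M)) ^ 2) with hC₁
  set C₂ : ℝ := 4 * β * (M * (noiseDensity σ 0 * (γ * (N * (2 * M)))))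
    + (|β| + γ * (N * (2 * M))) ^ 2 with hC₂
  set C : ℝ := max C₁ (Fintype.card (Edges G) * C₂) with hC
  refine coupled_decay (V := V) (R := R) (a := fun t => 2 * γ * L t + -(γ * lam2) * V t)
    (aV := fun t => 2 * γ * Lbar t + -(γ * lam2) * V t)
    (r := fun t => 2 * β * fMin σ c M * r t + -(γ * alpha G T lam2) * R t)
    (rR := fun t => 2 * β * fMin σ c M * rbar t + -(γ * alpha G T lam2) * R t)
    (A := γ * lam2) (B := γ * lamG G T / lam2)
    (D := 2 * β * fMin σ c M * piMin π - γ * alpha G T lam2) (C := C) (κ₀ := κ₀) (T₀ := t₀ + 1)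
    (fun t => integral_nonneg fun ω => real_dotProduct_self_nonneg _)
    (fun t => integral_nonneg fun ω => real_dotProduct_self_nonneg _)
    (div_pos (mul_pos H.gain_pos hlG) hl0) hκ₀ hdet ?_ ?_ ?_ ?_ ?_ ?_
  · intro t ht
    have htp : (0 : ℝ) < (t : ℝ) + 1 := by positivity
    have iL := (hLint t ht).1
    have j1 : Integrable (fun ω => 2 * γ * ((fun i => y t i ω) ⬝ᵥ
        (laplacian (G (m t ω)) *ᵥ fun i => y t i ω)) - γ * lam2 * disagreement y t ω) μ :=
      (iL.const_mul _).sub ((iV t ht).const_mul _)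
    have j2 : Integrable (fun ω => (γ * lamG G T / lam2 *
        (estError G y z t ω ⬝ᵥ estError G y z t ω)
      - (2 * γ * ((fun i => y t i ω) ⬝ᵥ (laplacian (G (m t ω)) *ᵥ fun i => y t i ω))
        - γ * lam2 * disagreement y t ω)) / ((t : ℝ) + 1)) μ :=
      (((iR t ht).const_mul _).sub j1).div_const _
    have j3 : Integrable (fun ω => disagreement y t ω + (γ * lamG G T / lam2 *
        (estError G y z t ω ⬝ᵥ estError G y z t ω)
      - (2 * γ * ((fun i => y t i ω) ⬝ᵥ (laplacian (G (m t ω)) *ᵥ fun i => y t i ω))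
        - γ * lam2 * disagreement y t ω)) / ((t : ℝ) + 1)) μ := (iV t ht).add j2
    refine (integral_mono (iV _ (by omega)) (j3.add (integrable_const _)) fun ω =>
      H.disagreement_succ_le hT hl0 ht ω).trans ?_
    rw [integral_add' j3 (integrable_const _), integral_add (iV t ht) j2, integral_div,
      integral_sub ((iR t ht).const_mul _) j1,
      integral_sub (iL.const_mul _) ((iV t ht).const_mul _), integral_const_mul,
      integral_const_mul, integral_const_mul, (hLint t ht).2, integral_const, probReal_univ,
      one_smul]
    have h1 : C₁ / ((t : ℝ) + 1) ^ 2 ≤ C / ((t : ℝ) + 1) ^ 2 :=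
      div_le_div_of_nonneg_right (le_max_left _ _) (by positivity)
    refine add_le_add (le_of_eq ?_) h1
    simp only [hV, hR]
    ring
  · intro t ht
    have htp : (0 : ℝ) < (t : ℝ) + 1 := by positivity
    have iδ : ∀ e : Edges G, Integrable (fun ω =>
        estError G y z t ω e * (y (t + 1) e.1.2 ω - y t e.1.2 ω)) μ := fun e =>
      (((H.isSlow_y e.1.2).integrable hmm hD (by omega : t₀ + 1 ≤ t + 1)).sub
        ((H.isSlow_y e.1.2).integrable hmm hD ht)).bdd_mul (c := 2 * M)
        ((H.isSlow_estError e).integrable hmm hD ht).aestronglyMeasurable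
        (ae_of_all _ fun ω => H.abs_estError_le ht e ω)
    have hsum := Finset.sum_le_sum fun (e : Edges G) (_ : e ∈ Finset.univ) =>
      H.integral_estError_succ_sq_le hσ hβ hd hmm hdm ht e
    rw [← H.integral_estError_dotProduct hmm hD (by omega)] at hsum
    simp only [Finset.sum_add_distrib, Finset.sum_sub_distrib, ← Finset.mul_sum,
      Finset.sum_const, Finset.card_univ, nsmul_eq_mul] at hsum
    rw [← H.integral_estError_dotProduct hmm hD ht] at hsum
    have hdrift : -2 * ∑ e : Edges G, ∫ ω, estError G y z t ω e *
        (y (t + 1) e.1.2 ω - y t e.1.2 ω) ∂μ ≤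
        (γ * alpha G T lam2 * R t + γ * lamG G T / lam2 * V t) / ((t : ℝ) + 1) := by
      rw [← integral_finsetSum _ fun e _ => iδ e, ← integral_const_mul]
      refine (integral_mono ((integrable_finsetSum _ fun e _ => iδ e).const_mul _)
        ((((iR t ht).const_mul _).add ((iV t ht).const_mul _)).div_const _) fun ω =>
        H.neg_two_mul_sum_estError_mul_drift_le hT hl0 hlG ht ω).trans (le_of_eq ?_)
      rw [integral_div]
      congr 1
      rw [← integral_const_mul, ← integral_const_mul]
      exact integral_add ((iR t ht).const_mul _) ((iV t ht).const_mul _)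
    have h1 : Fintype.card (Edges G) * C₂ / ((t : ℝ) + 1) ^ 2 ≤ C / ((t : ℝ) + 1) ^ 2 :=
      div_le_div_of_nonneg_right (le_max_right _ _) (by positivity)
    rw [mul_div_assoc] at h1
    have e3 : (γ * lamG G T / lam2 * V t - (2 * β * fMin σ c M * r t
        + -(γ * alpha G T lam2) * R t)) / ((t : ℝ) + 1) =
        (γ * alpha G T lam2 * R t + γ * lamG G T / lam2 * V t) / ((t : ℝ) + 1)
          - 2 * β * fMin σ c M / ((t : ℝ) + 1) * r t := by ring
    rw [e3]
    simp only [hR, hr] at hdrift ⊢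
    linarith
  · exact ((H.averages_laplacian hm hP hπ hD hdm).const_mul _).add (Averages.refl _ _)
  · exact ((Averages.sum _ fun e => H.averages_active hm hP hπ hD hdm e).const_mul _).add
      (Averages.refl _ _)
  · intro t ht
    have := mul_le_mul_of_nonneg_left (hLbarint t ht) (by linarith [H.gain_pos] : 0 ≤ 2 * γ)
    linarith
  · intro t ht
    have := mul_le_mul_of_nonneg_left (hrbarle t ht)
      (by positivity : 0 ≤ 2 * β * fMin σ c M)
    linarith

end ReducedLoop

open ReducedLoop

theorem alpha_nonneg {N h : ℕ} {G : Fin h → SimpleGraph (Fin N)} {T : Matrix (Fin N) (Fin N) ℝ}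
    {lam2 : ℝ} (hlam2 : 0 ≤ lam2) : 0 ≤ alpha G T lam2 := by
  classical
  have h1 : 0 ≤ lamQL G T := Real.iSup_nonneg fun u => sq_nonneg _
  have h2 : 0 ≤ lamG G T := Real.iSup_nonneg fun u => sq_nonneg _
  unfold alpha
  positivity

theorem piMin_pos {h : ℕ} (hh : Nonempty (Fin h)) {π : Fin h → ℝ} (hπ : ∀ u, 0 < π u) :
    0 < piMin π := by
  obtain ⟨u, hu⟩ := exists_eq_ciInf_of_finite (f := π)
  rw [piMin, ← hu]
  exact hπ u

end OneBitConsensus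

open OneBitConsensus in
theorem theorem3
    -- the agents (state dimension `p + 1`, in Brunovsky canonical form) and compression coefficients
    {p N h : ℕ} (hN : 2 ≤ N) (a : Fin (p + 1) → ℝ) (b : Fin p → ℝ)
    -- jointly connected topologies
    (G : Fin h → SimpleGraph (Fin N)) (hG : (unionGraph G).Connected)
    -- probability space, noises, switching signal
    {Ω : Type*} [MeasurableSpace Ω] (μ : Measure Ω) [IsProbabilityMeasure μ]
    (σ : ℝ≥0) (hσ : 0 < σ) (d : ℕ → Fin N → Fin N → Ω → ℝ) (hd : IsGaussianNoise μ σ d)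
    (P : Matrix (Fin h) (Fin h) ℝ) (hP : P.IsIrreducible)
    (m : ℕ → Ω → Fin h) (hm : IsMarkovChain μ P m)
    (π : Fin h → ℝ)
    (hπ : ∀ u, Tendsto (fun t => μ.real {ω | m t ω = u}) atTop (𝓝 (π u)))
    (hdm : IndepFun (fun ω (k : ℕ × Fin N × Fin N) => d k.1 k.2.1 k.2.2 ω)
      (fun ω (t : ℕ) => m t ω) μ)
    -- orthogonal diagonalization of the averaged Laplacian, eigenvalues in increasing order
    (T : Matrix (Fin N) (Fin N) ℝ) (hT : T ∈ Matrix.orthogonalGroup (Fin N) ℝ)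
    (lam : Fin N → ℝ) (hlam : Monotone lam)
    (hdiag : T⁻¹ * meanLaplacian G π * T = Matrix.diagonal lam)
    (lam2 : ℝ) (hlam2 : lam2 = lam ⟨1, hN⟩)
    -- the algorithm: thresholds, bound, step coefficients, initial time and initial values
    (c : Fin N → Fin N → ℝ) (M β γ : ℝ) (hγ : 0 < γ)
    (t₀ : ℕ) (ht₀ : 0 < t₀) (ht₀γ : ∀ i, γ * ((nbrs (unionGraph G) i).card : ℝ) - 1 < (t₀ : ℝ))
    (x₀ : Fin N → Fin (p + 1) → ℝ) (hx₀ : ∀ i, |compress b (x₀ i)| ≤ M)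
    (z₀ : Fin N → Fin N → ℝ) (hz₀ : ∀ i j, (unionGraph G).Adj i j → |z₀ i j| ≤ M)
    -- the states and the estimates that it generates
    (x : ℕ → Fin N → Ω → Fin (p + 1) → ℝ) (z : ℕ → Fin N → Fin N → Ω → ℝ)
    (hloop : ClosedLoop a b G σ c M β γ t₀ x₀ z₀ m d x z) :
    -- finite second moments
    (∀ t, t₀ + 1 ≤ t →
      (∀ i, MemLp (fun ω => compress b (x t i ω)) 2 μ) ∧
      (∀ i j, (unionGraph G).Adj i j → MemLp (fun ω => z t i j ω) 2 μ)) ∧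
    -- convergence
    (1 / (2 * fMin σ c M * piMin π) *
        (γ * lamG G T ^ 2 / lam2 ^ 3 + γ * alpha G T lam2) < β →
      (∀ i, Tendsto
        (fun t => ∫ ω, (compress b (x t i ω) - compress b (average fun k => x t k ω)) ^ 2 ∂μ)
        atTop (𝓝 0)) ∧
      (∀ i j, (unionGraph G).Adj i j → Tendsto
        (fun t => ∫ ω, (z t i j ω - compress b (x t j ω)) ^ 2 ∂μ) atTop (𝓝 0))) ∧
    -- rate of convergence
    (1 / (2 * fMin σ c M * piMin π) *
        (γ ^ 2 * lamG G T ^ 2 / (lam2 ^ 2 * (γ * lam2 - 1)) + γ * alpha G T lam2 + 1) < β →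
      1 / lam2 < γ →
      (∀ i, (fun t => ∫ ω,
          (compress b (x t i ω) - compress b (average fun k => x t k ω)) ^ 2 ∂μ)
        =O[atTop] fun t : ℕ => 1 / (t : ℝ)) ∧
      (∀ i j, (unionGraph G).Adj i j →
        (fun t => ∫ ω, (z t i j ω - compress b (x t j ω)) ^ 2 ∂μ)
          =O[atTop] fun t : ℕ => 1 / (t : ℝ))) := by
  have hH := hloop.reducedLoop hN hγ ht₀γ hx₀ hz₀
  have hD := ReducedLoop.measurable_noiseFamily hd.measurable
  have hmm := hm.measurable
  have hπ0 := hm.limit_pos hP hπ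
  have hl0 : 0 < lam2 := by
    rw [hlam2]; exact (lam_pos_and_le_dotProduct hN hG hπ0 hT hlam hdiag).1
  have hlG := lamG_pos hN hG hT
  have hf := fMin_pos (by omega : 0 < N) hσ c M
  have hα : 0 ≤ alpha G T lam2 := alpha_nonneg hl0.le
  have hh : Nonempty (Fin h) := by
    by_contra hne
    rw [not_nonempty_iff] at hne
    simpa using hm.sum_limit hπ
  have hpm := piMin_pos hh hπ0
  have hfp : 0 < 2 * fMin σ c M * piMin π := by positivity
  set y : ℕ → Fin N → Ω → ℝ := fun t i ω => compress b (x t i ω) with hy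
  have hdis : ∀ t i ω, (compress b (x t i ω) - compress b (average fun k => x t k ω)) ^ 2 ≤
      ReducedLoop.disagreement y t ω := by
    intro t i ω
    have e : compress b (x t i ω) - compress b (average fun k => x t k ω) =
        (matJ N *ᵥ fun i => y t i ω) i := by
      rw [matJ_mulVec_apply, compress_average]
    rw [e, sq]
    exact Finset.single_le_sum (f := fun i => (matJ N *ᵥ fun i => y t i ω) i *
      (matJ N *ᵥ fun i => y t i ω) i) (fun i _ => mul_self_nonneg _) (Finset.mem_univ i)
  have hest : ∀ t i j (hij : (unionGraph G).Adj i j) ω,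
      (z t i j ω - compress b (x t j ω)) ^ 2 ≤
      ReducedLoop.estError G y z t ω ⬝ᵥ ReducedLoop.estError G y z t ω := by
    intro t i j hij ω
    rw [sq]
    exact Finset.single_le_sum (f := fun e => ReducedLoop.estError G y z t ω e *
      ReducedLoop.estError G y z t ω e) (fun i _ => mul_self_nonneg _)
      (Finset.mem_univ (⟨(i, j), hij⟩ : Edges G))
  have hdisI : ∀ t, t₀ + 1 ≤ t → ∀ i,
      ∫ ω, (compress b (x t i ω) - compress b (average fun k => x t k ω)) ^ 2 ∂μ ≤
      ∫ ω, ReducedLoop.disagreement y t ω ∂μ := fun t ht i =>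
    integral_mono_of_nonneg (ae_of_all _ fun ω => sq_nonneg _)
      (hH.isSlow_disagreement.integrable hmm hD ht) (ae_of_all _ fun ω => hdis t i ω)
  have hestI : ∀ t, t₀ + 1 ≤ t → ∀ i j, (unionGraph G).Adj i j →
      ∫ ω, (z t i j ω - compress b (x t j ω)) ^ 2 ∂μ ≤
      ∫ ω, ReducedLoop.estError G y z t ω ⬝ᵥ ReducedLoop.estError G y z t ω ∂μ :=
    fun t ht i j hij => integral_mono_of_nonneg (ae_of_all _ fun ω => sq_nonneg _)
      (hH.isSlow_estError_dotProduct.integrable hmm hD ht)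
      (ae_of_all _ fun ω => hest t i j hij ω)
  refine ⟨fun t ht => ⟨fun i => (hH.isSlow_y i).memLp hmm hD ht 2,
    fun i j hij => (hH.isSlow_z hij).memLp hmm hD ht 2⟩, fun hβ => ?_, fun hβ hγ1 => ?_⟩
  · have hβ0 : 0 ≤ β := le_trans (by positivity) hβ.le
    rw [one_div, inv_mul_lt_iff₀ hfp] at hβ
    obtain ⟨κ, hκ, hdecay⟩ := hH.exists_decay hN hG hσ hd hP hm hπ hdm hT hlam hdiag hlam2 hβ0
      (κ₀ := 0) (by positivity) (by
        rw [sub_zero, sub_zero]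
        -- the threshold on `β`, multiplied by `γ * lam2`
        have e : (γ * lamG G T / lam2) ^ 2 = γ * lam2 * (γ * lamG G T ^ 2 / lam2 ^ 3) := by
          field_simp
        rw [e]
        exact mul_lt_mul_of_pos_left (by linarith) (by positivity))
    -- any positive rate `ρ ≤ 1` below `κ` will do
    have hρ0 : 0 < min (κ / 2) 1 := lt_min (by linarith) one_pos
    obtain ⟨K, hK⟩ := hdecay (min (κ / 2) 1) hρ0 (min_le_right _ _)
      ((min_le_left _ _).trans_lt (by linarith))
    have hlim : Tendsto (fun t : ℕ => K * (t : ℝ) ^ (-min (κ / 2) 1)) atTop (𝓝 0) := by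
      have := ((tendsto_rpow_neg_atTop hρ0).comp tendsto_natCast_atTop_atTop).const_mul K
      simpa using this
    constructor
    · intro i
      refine tendsto_of_tendsto_of_tendsto_of_le_of_le' tendsto_const_nhds hlim
        (Eventually.of_forall fun t => integral_nonneg fun ω => sq_nonneg _) ?_
      filter_upwards [hK, eventually_ge_atTop (t₀ + 1)] with t h1 h2
      exact (hdisI t h2 i).trans h1.1
    · intro i j hij
      refine tendsto_of_tendsto_of_tendsto_of_le_of_le' tendsto_const_nhds hlim
        (Eventually.of_forall fun t => integral_nonneg fun ω => sq_nonneg _) ?_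
      filter_upwards [hK, eventually_ge_atTop (t₀ + 1)] with t h1 h2
      exact (hestI t h2 i j hij).trans h1.2
  · have hγl : 1 < γ * lam2 := by rwa [div_lt_iff₀ hl0] at hγ1
    have hγl0 : 0 < γ * lam2 - 1 := by linarith
    have hβ0 : 0 ≤ β := le_trans (by positivity) hβ.le
    rw [one_div, inv_mul_lt_iff₀ hfp] at hβ
    obtain ⟨κ, hκ, hdecay⟩ := hH.exists_decay hN hG hσ hd hP hm hπ hdm hT hlam hdiag hlam2 hβ0
      (κ₀ := 1) hγl (by
        -- the threshold on `β`, multiplied by `γ * lam2 - 1`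
        have e : (γ * lamG G T / lam2) ^ 2 =
            (γ * lam2 - 1) * (γ ^ 2 * lamG G T ^ 2 / (lam2 ^ 2 * (γ * lam2 - 1))) := by
          field_simp
        rw [e]
        exact mul_lt_mul_of_pos_left (by linarith) hγl0)
    obtain ⟨K, hK⟩ := hdecay 1 one_pos le_rfl hκ
    have hO : ∀ f : ℕ → ℝ, (∀ t, 0 ≤ f t) → (∀ᶠ t : ℕ in atTop, f t ≤ K * (t : ℝ) ^ (-1 : ℝ)) →
        f =O[atTop] fun t : ℕ => 1 / (t : ℝ) := by
      intro f hf0 hfK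
      refine IsBigO.of_bound K ?_
      filter_upwards [hfK] with t h1
      rw [Real.rpow_neg_one, ← one_div] at h1
      rwa [Real.norm_of_nonneg (hf0 t), Real.norm_of_nonneg (by positivity)]
    constructor
    · intro i
      refine hO _ (fun t => integral_nonneg fun ω => sq_nonneg _) ?_
      filter_upwards [hK, eventually_ge_atTop (t₀ + 1)] with t h1 h2
      exact (hdisI t h2 i).trans h1.1
    · intro i j hij
      refine hO _ (fun t => integral_nonneg fun ω => sq_nonneg _) ?_
      filter_upwards [hK, eventually_ge_atTop (t₀ + 1)] with t h1 h2
      exact (hestI t h2 i j hij).trans h1.2
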